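/- Let $k\ge 0$, $m\ge 1$, $d\ge 0$ be integers and let $X_1,X_2,\dots$ be independent random vectors in $\mathbb R^k$, $X_\nu$ having the probability distribution $V'_\nu$. Put $V_n=\frac1n(V'_1+\dots+V'_n)$ and let $S_n=\frac1n\sum_{\nu\le n}\delta_{X_\nu}$ be the empirical distribution of the first $n$ results. For a distribution $V$ on $\mathbb R^k$ let $a_i(V)=\int x_i\,dV$ and $$M_{\nu_1\dots\nu_k}(V)=\int (x_1-a_1(V))^{\nu_1}\cdots(x_k-a_k(V))^{\nu_k}\,dV .$$ Choose finitely many multi-indices $\nu^{(1)},\dots,\nu^{(d)}$, each of order $\nu_1+\dots+\nu_k\le m$, and let $$f\{V\}=F\bigl(a_1(V),\dots,a_k(V),M_{\nu^{(1)}}(V),\dots,M_{\nu^{(d)}}(V)\bigr),$$ where $F$ is a real function that is of class $C^2$ on an open set $U\subset\mathbb R^{k}\times\mathbb R^{d}$, and where, for all large $n$, the vector of these means and moments of $V_n$ lies in a fixed compact set $K\subset U$. Assume that there are $N_1,\dots,N_k>0$, $\lambda$ and $\varepsilon>0$ such that, for all $\nu$ and all $i=1,\dots,k$, the distribution function $V'_{\nu,i}(t)=V'_\nu\{x: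 x_i\le t\}$ of the $i$-th coordinate satisfies $$V'_{\nu,i}(t)\le\lambda|t|^{-2m-k-\varepsilon}\ \ (t<-N_i),\qquad 1-V'_{\nu,i}(t)\le\lambda|t|^{-2m-k-\varepsilon}\ \ (t>N_i).$$ Let $J$ be the set of probability distributions on $\mathbb R^k$ with finite absolute moments of order $m$. A function $g$ on $\mathbb R^k$ is called a derivative $f'\{V_1,\cdot\}$ of $f$ at $V_1\in J$ if, for every $V\in J$, $g$ is $V$-integrable and the right derivative at $t=0$ of $t\mapsto f\{V_1+t(V-V_1)\}$, $0\le t\le 1$, exists and equals $\int g\,d(V-V_1)$. Then $f$ has a derivative at $V_n$ for all large $n$. Moreover, let $f'\{V_n,\cdot\}$ be a derivative of $f$ at $V_n$ (for all large $n$), let $s_n\ge 0$ be given by $$s_n^2=\sum_{\nu=1}^n\Bigl[\int f'\{V_n,Y\}^2\,dV'_\nu(Y)-\Bigl(\int f'\{V_n,Y\}\,dV'_\nu(Y)\Bigr)^2\Bigr],$$ and let $H_n=n/(\sqrt2\,s_n)$, i.e. $\frac1{2H_n^2}=\frac{s_n^2}{n^2}$. If $s_n/n^{1/(2+\delta)}\to\infty$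 for some $\delta>0$ with $m\delta<k+\varepsilon$, then, uniformly in $u\in\mathbb R$, $$\lim_{n\to\infty}\Pr\bigl(H_n[f\{S_n\}-f\{V_n\}]\le u\bigr)=\frac1{\sqrt\pi}\int_{-\infty}^u e^{-t^2}\,dt .$$ -/

import Mathlib

open MeasureTheory ProbabilityTheory Filter Topology
open scoped ENNReal

noncomputable section

namespace StatFun

/-- The mean `a_i = ∫ x_i dV` of the `i`-th coordinate. -/
def mean {k : ℕ} (V : Measure (Fin k → ℝ)) (i : Fin k) : ℝ :=
  ∫ x, x i ∂V

/-- The moment `M_{ν₁ … ν_k} = ∫ (x₁ - a₁)^{ν₁} ⋯ (x_k - a_k)^{ν_k} dV` about the mean. -/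
def moment {k : ℕ} (V : Measure (Fin k → ℝ)) (ν : Fin k → ℕ) : ℝ :=
  ∫ x, ∏ i, (x i - mean V i) ^ (ν i) ∂V

/-- The vector of the means `a_i` and of the moments `M_ν`, for `ν` in a finite family of
multi-indices. -/
def momentVector {k d : ℕ} (ν : Fin d → Fin k → ℕ) (V : Measure (Fin k → ℝ)) :
    (Fin k → ℝ) × (Fin d → ℝ) :=
  (fun i => mean V i, fun j => moment V (ν j))

/-- The probability distributions on `ℝ^k` with finite absolute moments of order `m`: a convex
set that contains all finitely supported distributions. -/
def finiteMoment (k m : ℕ) : Set (Measure (Fin k → ℝ)) :=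
  {V | IsProbabilityMeasure V ∧ ∀ i, Integrable (fun x : Fin k → ℝ => |x i| ^ m) V}

/-- The point `V₁ + t (V - V₁)`, `0 ≤ t ≤ 1`, of the segment from `V₁` to `V`. -/
def segmentPoint {E : Type*} [MeasurableSpace E] (V₁ V : Measure E) (t : ℝ) : Measure E :=
  ENNReal.ofReal (1 - t) • V₁ + ENNReal.ofReal t • V

/-- `g = f'{V₁, ·}`: the statistical function `f` is differentiable at `V₁ ∈ J`, that is, for
every `V ∈ J`, `d/dt f{V₁ + t (V - V₁)} = ∫ g d(V - V₁)` at `t = 0`. -/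
def HasStatDeriv {E : Type*} [MeasurableSpace E] (J : Set (Measure E)) (f : Measure E → ℝ)
    (V₁ : Measure E) (g : E → ℝ) : Prop :=
  V₁ ∈ J ∧ ∀ V ∈ J, Integrable g V ∧
    HasDerivWithinAt (fun t : ℝ => f (segmentPoint V₁ V t))
      ((∫ y, g y ∂V) - ∫ y, g y ∂V₁) (Set.Icc 0 1) 0

/-- The mean distribution `V_n` of the first `n` distributions. -/
def avgDist {E : Type*} [MeasurableSpace E] (V : ℕ → Measure E) (n : ℕ) : Measure E :=
  (n : ℝ≥0∞)⁻¹ • ∑ ν ∈ Finset.range n, V ν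

/-- The repartition `S_n` (empirical distribution) of the first `n` of the points `x_0, x_1, …`. -/
def repartition {E : Type*} [MeasurableSpace E] (x : ℕ → E) (n : ℕ) : Measure E :=
  avgDist (fun ν => Measure.dirac (x ν)) n

/-- `s_n`, where `s_n² = ∑_{ν < n} [∫ g² dV_ν - (∫ g dV_ν)²]`. -/
def dispersion {E : Type*} [MeasurableSpace E] (V : ℕ → Measure E) (g : E → ℝ) (n : ℕ) : ℝ :=
  √(∑ ν ∈ Finset.range n, ((∫ y, g y ^ 2 ∂(V ν)) - (∫ y, g y ∂(V ν)) ^ 2))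

/-- `H_n`, where `1 / (2 H_n²) = s_n² / n²`. -/
def normalizer {E : Type*} [MeasurableSpace E] (V : ℕ → Measure E) (g : E → ℝ) (n : ℕ) : ℝ :=
  n / (√2 * dispersion V g n)

/-- The Gauss function `φ(u) = π^{-1/2} ∫_{-∞}^u exp(-t²) dt`. -/
def gaussPhi (u : ℝ) : ℝ :=
  1 / √Real.pi * ∫ t in Set.Iic u, Real.exp (-t ^ 2)

/-- The tails of the coordinate distribution functions `V_{ν,i}` are at most `C |t|^{-p}`
beyond `N_i`, uniformly in `ν`. -/
def UniformTail {k : ℕ} (V : ℕ → Measure (Fin k → ℝ)) (N : Fin k → ℝ) (C p : ℝ) : Prop :=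
  ∀ (ν : ℕ) (i : Fin k) (t : ℝ),
    (t < -N i → cdf ((V ν).map (fun x => x i)) t ≤ C * |t| ^ (-p)) ∧
    (N i < t → 1 - cdf ((V ν).map (fun x => x i)) t ≤ C * |t| ^ (-p))

end StatFun

end

/-! Central moments are polynomials in the moments about `0`. Hence, on distributions with finite
moments of order `m`, the functional is `G (∫ φ dW)`, where `φ` (`monomialVector`) lists the
monomials of order at most `m` and `G = F ∘ Q` with a polynomial map `Q` (`momentMap`). Since `∫ φ
dS_n - ∫ φ dV_n` is the mean `Δ` of the independent centred vectors `φ(X_j) - E φ(X_j)`, the claim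
is a delta method around the moving point `r_n = ∫ φ dV_n`.

Testing against Dirac measures shows that every derivative at `V_n` is `DG(r_n) φ` plus a constant,
so `s_n²` is the variance of `∑ DG(r_n) φ(X_j)`. The linear term of the Taylor expansion, multiplied
by `H_n`, is a centred sum of variance `1/2`. With `q = 2 + δ`, its Lyapunov ratio is `O(n /
s_n^q)`, which vanishes because `s_n / n^(1/q) → ∞` (`tendsto_measureReal_linear`). The vectors
`φ(X_j)` have uniformly bounded `q`-th moments because `m q < 2m + k + ε`.

The quadratic remainder is at most `C ‖Δ‖²`, with `C` uniform because `r_n` stays in a compact set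
(`exists_taylor_bound`). As `E ‖Δ‖² = O(1/n)`, multiplication by `H_n` leaves `O(1/s_n) → 0` in
probability (`tendstoUniformly_smooth_mean`). Uniformity in `u` comes from monotonicity and
continuity of the limit. -/

namespace StatFun

/-! ### Lyapunov's theorem by characteristic functions -/

/-- Second order expansion of `exp (i x)`, the error being split into a small multiple of `x²`
and a multiple of `|x|^q`. -/
lemma exists_norm_exp_mul_I_sub_le {q η : ℝ} (hq : 2 < q) (hη : 0 < η) (hη1 : η ≤ 1) :
    ∃ C : ℝ, 0 ≤ C ∧ (∀ x : ℝ, ‖Complex.exp (x * Complex.I) - (1 + x * Complex.I - x ^ 2 / 2)‖ ≤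
      3 * η * x ^ 2 + C * |x| ^ q) ∧ ∀ x : ℝ, x ^ 2 ≤ η + C * |x| ^ q := by
  have hpow (x : ℝ) (hx : η < |x|) : (|x| / η) ^ 2 ≤ η ^ (-q) * |x| ^ q := by
    have h1 : 1 ≤ |x| / η := by rw [le_div_iff₀ hη]; linarith
    calc (|x| / η) ^ 2 = (|x| / η) ^ (2 : ℝ) := by norm_cast
      _ ≤ (|x| / η) ^ q := Real.rpow_le_rpow_of_exponent_le h1 hq.le
      _ = η ^ (-q) * |x| ^ q := by
        rw [Real.div_rpow (abs_nonneg x) hη.le, Real.rpow_neg hη.le]; ring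
  have hle (x : ℝ) : |x| ≤ |x| / η := by
    rw [le_div_iff₀ hη]; nlinarith [abs_nonneg x]
  -- For `|x| ≤ η` the cubic Taylor remainder suffices, with `exp |x| ≤ 3`. For `|x| > η` each term
  -- is bounded crudely by a multiple of `(|x| / η)²`, and the total factor `7/2` is rounded up to
  -- `4`.
  refine ⟨4 * η ^ (-q), by positivity, fun x => ?_, fun x => ?_⟩
  · rcases le_or_gt |x| η with hx | hx
    · have h := Complex.norm_exp_sub_sum_le_norm_mul_exp (x * Complex.I) 3
      have e1 : ∑ j ∈ Finset.range 3, ((x : ℂ) * Complex.I) ^ j / (j.factorial : ℂ) =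
          1 + x * Complex.I - x ^ 2 / 2 := by
        simp [Finset.sum_range_succ, mul_pow, Nat.factorial]
        ring
      have e2 : ‖(x : ℂ) * Complex.I‖ = |x| := by simp
      rw [e1, e2] at h
      have h3 : Real.exp |x| ≤ 3 :=
        (Real.exp_le_exp.2 (hx.trans hη1)).trans (by linarith [Real.exp_one_lt_d9])
      calc _ ≤ |x| ^ 3 * Real.exp |x| := h
        _ ≤ (η * x ^ 2) * 3 := by
          gcongr
          rw [← sq_abs x, pow_succ, mul_comm]
          gcongr
        _ ≤ _ := by
          have : 0 ≤ 4 * η ^ (-q) * |x| ^ q := by positivity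
          linarith
    · have hy := hpow x hx
      have h1 : 1 ≤ |x| / η := by rw [le_div_iff₀ hη]; linarith
      have h2 := hle x
      calc ‖Complex.exp (x * Complex.I) - (1 + x * Complex.I - x ^ 2 / 2)‖
          ≤ ‖Complex.exp (x * Complex.I)‖ + (‖(1 : ℂ)‖ + ‖(x : ℂ) * Complex.I‖ +
              ‖(x : ℂ) ^ 2 / 2‖) :=
            (norm_sub_le _ _).trans (add_le_add le_rfl ((norm_sub_le _ _).trans
              (add_le_add (norm_add_le _ _) le_rfl)))
        _ = 2 + |x| + |x| ^ 2 / 2 := by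
            rw [Complex.norm_exp_ofReal_mul_I]; simp; ring
        _ ≤ 4 * (|x| / η) ^ 2 := by nlinarith [abs_nonneg x]
        _ ≤ 4 * η ^ (-q) * |x| ^ q := by linarith
        _ ≤ _ := by
          have : 0 ≤ 3 * η * x ^ 2 := by positivity
          linarith
  · rcases le_or_gt |x| η with hx | hx
    · have : x ^ 2 ≤ η := by
        rw [← sq_abs]; nlinarith [abs_nonneg x]
      have : 0 ≤ 4 * η ^ (-q) * |x| ^ q := by positivity
      linarith
    · have hy := hpow x hx
      have h2 := hle x
      have : |x| ^ 2 ≤ (|x| / η) ^ 2 := by gcongr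
      have h3 : 0 ≤ η ^ (-q) * |x| ^ q := by positivity
      rw [← sq_abs]
      linarith

/-- Replace the factors one at a time; the remaining factors lie in the unit disc and do not enlarge
the difference. -/
lemma norm_prod_sub_prod_le {ι : Type*} (s : Finset ι) (a b : ι → ℂ) (ha : ∀ i, ‖a i‖ ≤ 1)
    (hb : ∀ i, ‖b i‖ ≤ 1) : ‖∏ i ∈ s, a i - ∏ i ∈ s, b i‖ ≤ ∑ i ∈ s, ‖a i - b i‖ := by
  classical
  induction s using Finset.induction_on with
  | empty => simp
  | insert i s hi ih =>
    rw [Finset.prod_insert hi, Finset.prod_insert hi, Finset.sum_insert hi]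
    have hp : ‖∏ i ∈ s, b i‖ ≤ 1 := by
      rw [norm_prod]
      exact Finset.prod_le_one (fun _ _ => norm_nonneg _) fun j _ => hb j
    calc _ = ‖(a i - b i) * ∏ i ∈ s, b i + a i * (∏ i ∈ s, a i - ∏ i ∈ s, b i)‖ := by ring_nf
      _ ≤ ‖a i - b i‖ * 1 + 1 * ∑ i ∈ s, ‖a i - b i‖ := by
        refine (norm_add_le _ _).trans ?_
        rw [norm_mul, norm_mul]
        gcongr
        exact ha i
      _ = _ := by ring

lemma integrable_sq_of_integrable_rpow {Ω : Type*} [MeasurableSpace Ω] {P : Measure Ω}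
    [IsFiniteMeasure P] {Z : Ω → ℝ} {q : ℝ} (hq : 2 ≤ q) (hZ : AEMeasurable Z P)
    (hZq : Integrable (fun ω => |Z ω| ^ q) P) : MemLp Z 2 P := by
  have h0 : MemLp Z (ENNReal.ofReal q) P := by
    rw [← integrable_norm_rpow_iff hZ.aestronglyMeasurable (by simp; linarith) (by simp),
      ENNReal.toReal_ofReal (by linarith)]
    exact hZq
  refine h0.mono_exponent ?_
  rw [← ENNReal.ofReal_ofNat]
  exact ENNReal.ofReal_le_ofReal hq

/-- With `v` the variance, both quantities are compared with `1 - v/2`: the first by integrating the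
expansion, whose linear term has mean zero, the second by expanding `exp`. The smallness hypothesis
gives `v ≤ 2η`, so that the error of order `v²` is absorbed in `2ηv`. -/
lemma norm_charFun_one_sub_exp_le {Ω : Type*} [MeasurableSpace Ω] {P : Measure Ω}
    [IsProbabilityMeasure P] {q η C : ℝ} (hq : 2 < q)
    (hC1 : ∀ x : ℝ, ‖Complex.exp (x * Complex.I) - (1 + x * Complex.I - x ^ 2 / 2)‖ ≤
      3 * η * x ^ 2 + C * |x| ^ q) (hC2 : ∀ x : ℝ, x ^ 2 ≤ η + C * |x| ^ q)
    {Z : Ω → ℝ} (hZ : AEMeasurable Z P) (hZq : Integrable (fun ω => |Z ω| ^ q) P)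
    (hZ0 : ∫ ω, Z ω ∂P = 0) (hsmall : C * ∫ ω, |Z ω| ^ q ∂P ≤ η) (hη : η ≤ 1 / 2) :
    ‖charFun (P.map Z) 1 - Complex.exp (-((∫ ω, Z ω ^ 2 ∂P : ℝ) : ℂ) / 2)‖ ≤
      5 * η * ∫ ω, Z ω ^ 2 ∂P + C * ∫ ω, |Z ω| ^ q ∂P := by
  have hL2 := integrable_sq_of_integrable_rpow hq.le hZ hZq
  have hi2 : Integrable (fun ω => Z ω ^ 2) P := hL2.integrable_sq
  have hi1 : Integrable Z P := hL2.integrable (by norm_num)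
  set v := ∫ ω, Z ω ^ 2 ∂P with hv
  set ρ := ∫ ω, |Z ω| ^ q ∂P with hρ
  have hv0 : 0 ≤ v := integral_nonneg fun _ => sq_nonneg _
  have hvle : v ≤ η + C * ρ := by
    calc v ≤ ∫ ω, (η + C * |Z ω| ^ q) ∂P :=
          integral_mono hi2 ((integrable_const _).add (hZq.const_mul _)) fun ω => hC2 _
      _ = η + C * ρ := by
          rw [integral_add (integrable_const _) (hZq.const_mul _), integral_const_mul]; simp [hρ]
  have hch : charFun (P.map Z) 1 = ∫ ω, Complex.exp (Z ω * Complex.I) ∂P := by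
    rw [charFun_apply_real, integral_map hZ (by fun_prop)]
    simp
  have hie : Integrable (fun ω => Complex.exp (Z ω * Complex.I)) P := by
    refine Integrable.of_bound (C := 1) ?_ (ae_of_all _ fun ω => ?_)
    · exact (by fun_prop : AEMeasurable (fun ω => Complex.exp (Z ω * Complex.I)) P).aestronglyMeasurable
    · rw [Complex.norm_exp_ofReal_mul_I]
  have hiT : Integrable (fun ω => (1 + Z ω * Complex.I - (Z ω : ℂ) ^ 2 / 2)) P := by
    have h2 : Integrable (fun ω => ((Z ω : ℂ) ^ 2 / 2)) P := by
      have := (hi2.ofReal (𝕜 := ℂ)).div_const 2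
      simpa using this
    exact ((integrable_const _).add (hi1.ofReal.mul_const _)).sub h2
  have hT : ∫ ω, (1 + Z ω * Complex.I - (Z ω : ℂ) ^ 2 / 2) ∂P = 1 - (v : ℂ) / 2 := by
    have h2 : Integrable (fun ω => ((Z ω : ℂ) ^ 2 / 2)) P := by
      have := (hi2.ofReal (𝕜 := ℂ)).div_const 2
      simpa using this
    have hz : Integrable (fun ω => (Z ω : ℂ) * Complex.I) P := hi1.ofReal.mul_const _
    have h1z : Integrable (fun ω => 1 + (Z ω : ℂ) * Complex.I) P := (integrable_const _).add hz
    rw [integral_sub h1z h2, integral_add (integrable_const _) hz,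
      integral_mul_const, integral_complex_ofReal, hZ0, integral_div]
    have : ∫ ω, (Z ω : ℂ) ^ 2 ∂P = (v : ℂ) := by
      rw [hv, ← integral_complex_ofReal]; simp
    rw [this]; simp
  have hA : ‖charFun (P.map Z) 1 - (1 - (v : ℂ) / 2)‖ ≤ 3 * η * v + C * ρ := by
    rw [hch, ← hT, ← integral_sub hie hiT]
    calc _ ≤ ∫ ω, (3 * η * Z ω ^ 2 + C * |Z ω| ^ q) ∂P :=
          norm_integral_le_of_norm_le ((hi2.const_mul _).add (hZq.const_mul _))
            (ae_of_all _ fun ω => hC1 _)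
      _ = _ := by
          rw [integral_add (hi2.const_mul _) (hZq.const_mul _), integral_const_mul,
            integral_const_mul]
  have hB : ‖(1 - (v : ℂ) / 2) - Complex.exp (-(v : ℂ) / 2)‖ ≤ 2 * η * v := by
    have h := Real.abs_exp_sub_one_sub_id_le (x := -v / 2) (by rw [abs_le]; constructor <;> linarith)
    have e : (1 - (v : ℂ) / 2) - Complex.exp (-(v : ℂ) / 2) =
        ((-(Real.exp (-v / 2) - 1 - -v / 2) : ℝ) : ℂ) := by push_cast; ring
    rw [e, Complex.norm_real, Real.norm_eq_abs, abs_neg]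
    refine h.trans ?_
    nlinarith
  calc _ ≤ _ := norm_sub_le_norm_sub_add_norm_sub _ (1 - (v : ℂ) / 2) _
    _ ≤ _ := by linarith

/-- Lyapunov's theorem for triangular arrays, in terms of characteristic functions at `1`. -/
lemma tendsto_charFun_one_array {Ω : Type*} [MeasurableSpace Ω] {P : Measure Ω}
    [IsProbabilityMeasure P] {q v : ℝ} (hq : 2 < q) {Z : ℕ → ℕ → Ω → ℝ}
    (hZ : ∀ n j, AEMeasurable (Z n j) P) (hind : ∀ n, iIndepFun (Z n) P)
    (hZq : ∀ n j, Integrable (fun ω => |Z n j ω| ^ q) P) (hZ0 : ∀ n j, ∫ ω, Z n j ω ∂P = 0)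
    (hvar : Tendsto (fun n => ∑ j ∈ Finset.range n, ∫ ω, Z n j ω ^ 2 ∂P) atTop (𝓝 v))
    (hlyap : Tendsto (fun n => ∑ j ∈ Finset.range n, ∫ ω, |Z n j ω| ^ q ∂P) atTop (𝓝 0)) :
    Tendsto (fun n => charFun (P.map (fun ω => ∑ j ∈ Finset.range n, Z n j ω)) 1) atTop
      (𝓝 (Complex.exp (-(v : ℂ) / 2))) := by
  set A := fun n => ∑ j ∈ Finset.range n, ∫ ω, Z n j ω ^ 2 ∂P with hA
  set R := fun n => ∑ j ∈ Finset.range n, ∫ ω, |Z n j ω| ^ q ∂P with hR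
  have hlim : Tendsto (fun n => Complex.exp (-(A n : ℂ) / 2)) atTop
      (𝓝 (Complex.exp (-(v : ℂ) / 2))) := by
    have : Continuous fun x : ℝ => Complex.exp (-(x : ℂ) / 2) := by fun_prop
    exact (this.tendsto v).comp hvar
  -- It is enough to approach `exp (-A n / 2)`, which factors over the summands like the
  -- characteristic function does.
  refine (tendsto_iff_of_dist ?_).1 hlim
  have hv0 : 0 ≤ v := ge_of_tendsto' hvar fun n =>
    Finset.sum_nonneg fun j _ => integral_nonneg fun _ => sq_nonneg _
  rw [Metric.tendsto_nhds]
  intro r hr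
  -- Eventually `A n < v + 1` and `C * R n < η`, so the final error is at most `η (5 (v + 1) + 1)`.
  obtain ⟨η, hη, hη2, hηr⟩ : ∃ η : ℝ, 0 < η ∧ η ≤ 1 / 2 ∧ η * (5 * (v + 1) + 1) < r := by
    refine ⟨min (1 / 2) (r / (2 * (5 * (v + 1) + 1))), by positivity, min_le_left _ _, ?_⟩
    calc _ ≤ r / (2 * (5 * (v + 1) + 1)) * (5 * (v + 1) + 1) := by
          gcongr; exact min_le_right _ _
      _ = r / 2 := by field_simp
      _ < r := by linarith
  obtain ⟨C, hC0, hC1, hC2⟩ := exists_norm_exp_mul_I_sub_le hq hη (hη2.trans (by norm_num))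
  have hCR : Tendsto (fun n => C * R n) atTop (𝓝 0) := by simpa using hlyap.const_mul C
  filter_upwards [hCR.eventually (gt_mem_nhds hη), hvar.eventually (gt_mem_nhds (lt_add_one v))]
    with n hn1 hn2
  rw [dist_zero_right, Real.norm_of_nonneg dist_nonneg, dist_comm, dist_eq_norm,
    ((hind n).restrict _).charFun_map_fun_finsetSum_eq_prod fun j _ => hZ n j]
  have e : Complex.exp (-(A n : ℂ) / 2) = ∏ j ∈ Finset.range n,
      Complex.exp (-((∫ ω, Z n j ω ^ 2 ∂P : ℝ) : ℂ) / 2) := by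
    rw [← Complex.exp_sum, hA]
    push_cast
    rw [← Finset.sum_div, Finset.sum_neg_distrib]
  rw [e, Finset.prod_apply]
  refine (norm_prod_sub_prod_le _ _ _ (fun j => ?_) fun j => ?_).trans_lt ?_
  · have := Measure.isProbabilityMeasure_map (hZ n j)
    exact norm_charFun_le_one _
  · have e : -((∫ ω, Z n j ω ^ 2 ∂P : ℝ) : ℂ) / 2 = ((-(∫ ω, Z n j ω ^ 2 ∂P) / 2 : ℝ) : ℂ) := by
      push_cast; ring
    rw [e, ← Complex.ofReal_exp, Complex.norm_real, Real.norm_of_nonneg (Real.exp_nonneg _),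
      Real.exp_le_one_iff]
    have : 0 ≤ ∫ ω, Z n j ω ^ 2 ∂P := integral_nonneg fun _ => sq_nonneg _
    linarith
  · calc _ ≤ ∑ j ∈ Finset.range n,
          (5 * η * ∫ ω, Z n j ω ^ 2 ∂P + C * ∫ ω, |Z n j ω| ^ q ∂P) := by
          refine Finset.sum_le_sum fun j hj => norm_charFun_one_sub_exp_le hq hC1 hC2 (hZ n j)
            (hZq n j) (hZ0 n j) (le_trans ?_ hn1.le) hη2
          gcongr
          exact Finset.single_le_sum (f := fun j => ∫ ω, |Z n j ω| ^ q ∂P)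
            (fun i _ => integral_nonneg fun _ => by positivity) hj
      _ = 5 * η * A n + C * R n := by
          rw [Finset.sum_add_distrib, ← Finset.mul_sum, ← Finset.mul_sum]
      _ ≤ 5 * η * (v + 1) + η := by gcongr
      _ < r := by linarith

/-! ### The Gauss function and uniform convergence -/

/-- The density `exp (-t²) / √π` is that of variance `1/2`, which accounts for the factor `√2` in
the normalizer. -/
lemma gaussPhi_eq (u : ℝ) : gaussPhi u = (gaussianReal 0 (1 / 2)).real (Set.Iic u) := by
  rw [measureReal_def, gaussianReal_apply_eq_integral _ (by norm_num),
    ENNReal.toReal_ofReal (integral_nonneg fun _ => gaussianPDFReal_nonneg _ _ _), gaussPhi,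
    ← integral_const_mul]
  congr 1
  ext t
  have h2 : (2 : ℝ) * Real.pi * ((1 / 2 : NNReal) : ℝ) = Real.pi := by push_cast; ring
  rw [gaussianPDFReal_def, h2]
  simp

lemma gaussPhi_eq_cdf (u : ℝ) : gaussPhi u = cdf (gaussianReal 0 (1 / 2)) u := by
  rw [gaussPhi_eq, cdf_eq_real]

lemma continuous_gaussPhi : Continuous gaussPhi := by
  have hi : Integrable (fun t : ℝ => Real.exp (-t ^ 2)) := by
    simpa using integrable_exp_neg_mul_sq (b := 1) one_pos
  have h : gaussPhi = fun u => 1 / √Real.pi * ((∫ t in Set.Iic 0, Real.exp (-t ^ 2)) +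
      ∫ t in (0 : ℝ)..u, Real.exp (-t ^ 2)) := by
    ext u
    rw [gaussPhi, intervalIntegral.integral_Iic_sub_Iic hi.integrableOn hi.integrableOn |>.symm]
    ring
  rw [h]
  exact continuous_const.mul (continuous_const.add
    (intervalIntegral.continuous_primitive (fun a b => hi.intervalIntegrable) 0))

lemma monotone_gaussPhi : Monotone gaussPhi := by
  intro a b hab
  rw [gaussPhi_eq_cdf, gaussPhi_eq_cdf]
  exact monotone_cdf _ hab

lemma tendsto_gaussPhi_atBot : Tendsto gaussPhi atBot (𝓝 0) :=
  (tendsto_cdf_atBot (gaussianReal 0 (1 / 2))).congr fun u => (gaussPhi_eq_cdf u).symm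

lemma tendsto_gaussPhi_atTop : Tendsto gaussPhi atTop (𝓝 1) :=
  (tendsto_cdf_atTop (gaussianReal 0 (1 / 2))).congr fun u => (gaussPhi_eq_cdf u).symm

/-- Pólya's theorem: pointwise convergence of distribution functions to a continuous one is
uniform. -/
lemma tendstoUniformly_of_monotone {G : ℕ → ℝ → ℝ} {Φ : ℝ → ℝ} (hG : ∀ n, Monotone (G n))
    (hG0 : ∀ n u, 0 ≤ G n u) (hG1 : ∀ n u, G n u ≤ 1) (hΦ : Continuous Φ) (hmono : Monotone Φ)
    (hbot : Tendsto Φ atBot (𝓝 0)) (htop : Tendsto Φ atTop (𝓝 1))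
    (hlim : ∀ u, Tendsto (fun n => G n u) atTop (𝓝 (Φ u))) :
    TendstoUniformly G Φ atTop := by
  have hΦ0 (u) : 0 ≤ Φ u := ge_of_tendsto' (hlim u) fun n => hG0 n u
  have hΦ1 (u) : Φ u ≤ 1 := le_of_tendsto' (hlim u) fun n => hG1 n u
  rw [Metric.tendstoUniformly_iff]
  intro r hr
  obtain ⟨a, ha⟩ := (hbot.eventually (gt_mem_nhds (half_pos hr))).exists
  obtain ⟨b, hb⟩ := (htop.eventually (lt_mem_nhds (sub_lt_self 1 (half_pos hr)))).exists
  -- Near `x`, monotonicity traps both functions between their values at `x ± δ/2`; compactness of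
  -- `[a, b]` finishes. Outside `[a, b]` both are near `0` or `1`.
  have hloc : TendstoLocallyUniformlyOn G Φ atTop (Set.Icc a b) := by
    rw [Metric.tendstoLocallyUniformlyOn_iff]
    intro r hr x _
    obtain ⟨δ, hδ, h⟩ := Metric.continuous_iff.1 hΦ x (r / 4) (by positivity)
    have h1 := h (x - δ / 2) (by rw [Real.dist_eq, abs_lt]; constructor <;> linarith)
    have h2 := h (x + δ / 2) (by rw [Real.dist_eq, abs_lt]; constructor <;> linarith)
    refine ⟨Set.Ioo (x - δ / 2) (x + δ / 2), mem_nhdsWithin_of_mem_nhds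
      (Ioo_mem_nhds (by linarith) (by linarith)), ?_⟩
    have e1 := Metric.tendsto_nhds.1 (hlim (x - δ / 2)) (r / 4) (by positivity)
    have e2 := Metric.tendsto_nhds.1 (hlim (x + δ / 2)) (r / 4) (by positivity)
    filter_upwards [e1, e2] with n h3 h4 y hy
    have m1 := hG n hy.1.le
    have m2 := hG n hy.2.le
    have m3 := hmono hy.1.le
    have m4 := hmono hy.2.le
    rw [Real.dist_eq, abs_lt] at *
    constructor <;> linarith
  have hun := (tendstoLocallyUniformlyOn_iff_tendstoUniformlyOn_of_compact isCompact_Icc).1 hloc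
  rw [Metric.tendstoUniformlyOn_iff] at hun
  filter_upwards [hun r hr, (hlim a).eventually (gt_mem_nhds ha),
    (hlim b).eventually (lt_mem_nhds hb)] with n h1 h2 h3 x
  rcases lt_or_ge x a with hx | hx
  · have m1 := hG n hx.le
    have m2 := hmono hx.le
    have := hG0 n x
    have := hΦ0 x
    rw [Real.dist_eq, abs_lt]
    constructor <;> linarith
  rcases lt_or_ge b x with hx' | hx'
  · have m1 := hG n hx'.le
    have m2 := hmono hx'.le
    have := hG1 n x
    have := hΦ1 x
    rw [Real.dist_eq, abs_lt]
    constructor <;> linarith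
  · exact h1 x ⟨hx, hx'⟩

/-! ### Convergence in law and the delta method -/

section Convergence

variable {Ω : Type*} [MeasurableSpace Ω] {P : Measure Ω} [IsProbabilityMeasure P]

/-- Lévy's continuity theorem followed by the portmanteau theorem: the boundary point of a half-line
is a null set for the Gaussian. -/
lemma tendsto_measureReal_le_of_tendsto_charFun {T : ℕ → Ω → ℝ} (hT : ∀ n, AEMeasurable (T n) P)
    (h : ∀ t : ℝ, Tendsto (fun n => charFun (P.map (T n)) t) atTop
      (𝓝 (Complex.exp (-(t : ℂ) ^ 2 / 4)))) (u : ℝ) :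
    Tendsto (fun n => P.real {ω | T n ω ≤ u}) atTop (𝓝 (gaussPhi u)) := by
  let μ : ℕ → ProbabilityMeasure ℝ := fun n => ⟨P.map (T n), Measure.isProbabilityMeasure_map (hT n)⟩
  let μ₀ : ProbabilityMeasure ℝ := ⟨gaussianReal 0 (1 / 2), inferInstance⟩
  have hμ : Tendsto μ atTop (𝓝 μ₀) := by
    refine ProbabilityMeasure.tendsto_iff_tendsto_charFun.2 fun t => ?_
    have e : charFun (μ₀ : Measure ℝ) t = Complex.exp (-(t : ℂ) ^ 2 / 4) := by
      change charFun (gaussianReal 0 (1 / 2)) t = _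
      rw [charFun_gaussianReal]
      congr 1
      push_cast
      ring
    rw [e]
    exact h t
  have hfr : (μ₀ : Measure ℝ) (frontier (Set.Iic u)) = 0 := by
    rw [frontier_Iic]
    have := nullSingletonClass_gaussianReal (μ := 0) (v := 1 / 2) (by norm_num)
    change gaussianReal 0 (1 / 2) {u} = 0
    exact measure_singleton u
  have := ProbabilityMeasure.tendsto_measure_of_null_frontier_of_tendsto' hμ hfr
  have h2 := (ENNReal.tendsto_toReal (measure_ne_top (μ₀ : Measure ℝ) _)).comp this
  have e0 : gaussPhi u = ((μ₀ : Measure ℝ) (Set.Iic u)).toReal := gaussPhi_eq u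
  rw [e0]
  refine h2.congr fun n => ?_
  change (P.map (T n) (Set.Iic u)).toReal = _
  rw [Measure.map_apply_of_aemeasurable (hT n) measurableSet_Iic]
  rfl

/-- Slutsky's argument: off an event of small probability, `D n ≤ u` lies between `T n ≤ u - δ/2`
and `T n ≤ u + δ/2`, and `Φ` hardly changes there. -/
lemma tendsto_measureReal_le_of_abs_sub {T D : ℕ → Ω → ℝ} {Φ : ℝ → ℝ} (hΦ : Continuous Φ)
    (hT : ∀ u, Tendsto (fun n => P.real {ω | T n ω ≤ u}) atTop (𝓝 (Φ u)))
    (hD : ∀ η > 0, Tendsto (fun n => P.real {ω | η < |D n ω - T n ω|}) atTop (𝓝 0)) (u : ℝ) :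
    Tendsto (fun n => P.real {ω | D n ω ≤ u}) atTop (𝓝 (Φ u)) := by
  rw [Metric.tendsto_nhds]
  intro r hr
  obtain ⟨δ, hδ, h⟩ := Metric.continuous_iff.1 hΦ u (r / 3) (by positivity)
  have h1 := h (u - δ / 2) (by rw [Real.dist_eq, abs_lt]; constructor <;> linarith)
  have h2 := h (u + δ / 2) (by rw [Real.dist_eq, abs_lt]; constructor <;> linarith)
  filter_upwards [Metric.tendsto_nhds.1 (hT (u - δ / 2)) (r / 3) (by positivity),
    Metric.tendsto_nhds.1 (hT (u + δ / 2)) (r / 3) (by positivity),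
    Metric.tendsto_nhds.1 (hD (δ / 2) (by positivity)) (r / 3) (by positivity)] with n h3 h4 h5
  have i1 : P.real {ω | D n ω ≤ u} ≤ P.real {ω | T n ω ≤ u + δ / 2} +
      P.real {ω | δ / 2 < |D n ω - T n ω|} := by
    refine (measureReal_mono ?_).trans (measureReal_union_le _ _)
    intro ω (hω : D n ω ≤ u)
    rcases le_or_gt (T n ω) (u + δ / 2) with h | h
    · exact Or.inl h
    · right
      change δ / 2 < |D n ω - T n ω|
      rw [lt_abs]; right; linarith
  have i2 : P.real {ω | T n ω ≤ u - δ / 2} ≤ P.real {ω | D n ω ≤ u} +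
      P.real {ω | δ / 2 < |D n ω - T n ω|} := by
    refine (measureReal_mono ?_).trans (measureReal_union_le _ _)
    intro ω (hω : T n ω ≤ u - δ / 2)
    rcases le_or_gt (D n ω) u with h | h
    · exact Or.inl h
    · right
      change δ / 2 < |D n ω - T n ω|
      rw [lt_abs]; left; linarith
  rw [Real.dist_eq, abs_lt] at *
  constructor <;> linarith

/-- Chebyshev's inequality for the arithmetic mean of independent centred random vectors. -/
lemma measureReal_le_norm_mean_sq {ι : Type*} [Fintype ι] {W : ℕ → Ω → ι → ℝ}
    (hind : iIndepFun W P) (hL2 : ∀ j β, MemLp (fun ω => W j ω β) 2 P)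
    (h0 : ∀ j β, ∫ ω, W j ω β ∂P = 0) {B : ℝ} (hB : ∀ j β, ∫ ω, W j ω β ^ 2 ∂P ≤ B)
    {n : ℕ} (hn : n ≠ 0) {c : ℝ} (hc : 0 < c) :
    P.real {ω | c ≤ ‖(n : ℝ)⁻¹ • ∑ j ∈ Finset.range n, W j ω‖ ^ 2} ≤
      Fintype.card ι * B / n / c := by
  have hsum (β : ι) : ∫ ω, (∑ j ∈ Finset.range n, W j ω β) ^ 2 ∂P ≤ n * B := by
    have hv : variance (∑ j ∈ Finset.range n, fun ω => W j ω β) P =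
        ∑ j ∈ Finset.range n, variance (fun ω => W j ω β) P := by
      refine IndepFun.variance_sum (fun j _ => hL2 j β) fun i _ j _ hij => ?_
      exact (hind.indepFun hij).comp (measurable_pi_apply β) (measurable_pi_apply β)
    rw [variance_of_integral_eq_zero
      (Finset.aemeasurable_sum _ fun j _ => (hL2 j β).aestronglyMeasurable.aemeasurable)] at hv
    · simp only [Finset.sum_apply] at hv
      rw [hv]
      calc _ ≤ ∑ j ∈ Finset.range n, B := by
            refine Finset.sum_le_sum fun j _ => ?_
            rw [variance_of_integral_eq_zero (hL2 j β).aestronglyMeasurable.aemeasurable (h0 j β)]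
            exact hB j β
        _ = n * B := by simp
    · simp only [Finset.sum_apply]
      rw [integral_finsetSum _ fun j _ => (hL2 j β).integrable (by norm_num)]
      simp [h0]
  have hint (β : ι) : Integrable (fun ω => (∑ j ∈ Finset.range n, W j ω β) ^ 2) P :=
    (memLp_finsetSum _ fun j _ => hL2 j β).integrable_sq
  -- The squared sup norm is at most the sum of the squared coordinates, whose expectations are sums
  -- of variances by independence.
  set f : Ω → ℝ := fun ω => (n : ℝ)⁻¹ ^ 2 * ∑ β, (∑ j ∈ Finset.range n, W j ω β) ^ 2 with hf
  have hfi : Integrable f P := (integrable_finsetSum _ fun β _ => hint β).const_mul _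
  have hfle : ∫ ω, f ω ∂P ≤ Fintype.card ι * B / n := by
    rw [hf, integral_const_mul, integral_finsetSum _ fun β _ => hint β]
    calc _ ≤ (n : ℝ)⁻¹ ^ 2 * ∑ _β : ι, (n * B) := by
          gcongr with β; exact hsum β
      _ = _ := by
          simp only [Finset.sum_const, Finset.card_univ, nsmul_eq_mul]
          field_simp
  have hsub : {ω | c ≤ ‖(n : ℝ)⁻¹ • ∑ j ∈ Finset.range n, W j ω‖ ^ 2} ⊆ {ω | c ≤ f ω} := by
    intro ω hω
    refine le_trans (b := ‖(n : ℝ)⁻¹ • ∑ j ∈ Finset.range n, W j ω‖ ^ 2) hω ?_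
    have hb : ‖∑ j ∈ Finset.range n, W j ω‖ ≤ √(∑ β, (∑ j ∈ Finset.range n, W j ω β) ^ 2) := by
      rw [pi_norm_le_iff_of_nonneg (Real.sqrt_nonneg _)]
      intro β
      rw [Finset.sum_apply]
      refine Real.abs_le_sqrt ?_
      exact Finset.single_le_sum (f := fun β => (∑ j ∈ Finset.range n, W j ω β) ^ 2)
        (fun _ _ => sq_nonneg _) (Finset.mem_univ β)
    have hs : 0 ≤ ∑ β, (∑ j ∈ Finset.range n, W j ω β) ^ 2 :=
      Finset.sum_nonneg fun _ _ => sq_nonneg _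
    rw [norm_smul, mul_pow, hf, norm_inv, Real.norm_natCast]
    refine mul_le_mul_of_nonneg_left ?_ (by positivity)
    calc _ ≤ √(∑ β, (∑ j ∈ Finset.range n, W j ω β) ^ 2) ^ 2 := by gcongr
      _ = _ := Real.sq_sqrt hs
  rw [le_div_iff₀ hc, mul_comm]
  calc _ ≤ c * P.real {ω | c ≤ f ω} := mul_le_mul_of_nonneg_left (measureReal_mono hsub) hc.le
    _ ≤ ∫ ω, f ω ∂P := mul_meas_ge_le_integral_of_nonneg (ae_of_all _ fun ω => by positivity) hfi c
    _ ≤ _ := hfle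

/-- A closed thickening of `K` is still compact and inside `U`, so the first two derivatives are
bounded on it. The mean value inequality, applied to the derivative and then to `G` minus its linear
part, gives constants independent of `z`. -/
lemma exists_taylor_bound {E : Type*} [NormedAddCommGroup E] [NormedSpace ℝ E] [ProperSpace E]
    {G : E → ℝ} {U K : Set E} (hU : IsOpen U) (hK : IsCompact K) (hKU : K ⊆ U)
    (hG : ContDiffOn ℝ 2 G U) :
    ∃ ρ > 0, ∃ C : ℝ, 0 < C ∧ ∀ z ∈ K, ‖fderiv ℝ G z‖ ≤ C ∧ ∀ h : E, ‖h‖ ≤ ρ →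
      |G (z + h) - G z - fderiv ℝ G z h| ≤ C * ‖h‖ ^ 2 := by
  obtain ⟨ρ, hρ, hsub⟩ := hK.exists_cthickening_subset_open hU hKU
  have hc : IsCompact (Metric.cthickening ρ K) := hK.cthickening
  have h1 : ContDiffOn ℝ 1 (fderiv ℝ G) U := hG.fderiv_of_isOpen hU (by norm_num)
  have h2 : ContinuousOn (fderiv ℝ (fderiv ℝ G)) U :=
    h1.continuousOn_fderiv_of_isOpen hU le_rfl
  obtain ⟨C₁, hC₁⟩ := hc.exists_bound_of_continuousOn (h1.continuousOn.mono hsub)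
  obtain ⟨C₂, hC₂⟩ :=
    hc.exists_bound_of_continuousOn (f := fderiv ℝ (fderiv ℝ G)) (h2.mono hsub)
  refine ⟨ρ, hρ, max 1 (max C₁ C₂), by positivity, fun z hz => ⟨?_, fun h hh => ?_⟩⟩
  · exact (hC₁ z (Metric.self_subset_cthickening K hz)).trans
      ((le_max_left _ _).trans (le_max_right _ _))
  · set C := max 1 (max C₁ C₂)
    have hball : Metric.closedBall z ‖h‖ ⊆ Metric.cthickening ρ K := fun x hx =>
      Metric.mem_cthickening_of_dist_le x z ρ K hz ((Metric.mem_closedBall.1 hx).trans hh)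
    have hzb : z ∈ Metric.closedBall z ‖h‖ := Metric.mem_closedBall_self (norm_nonneg h)
    have hlip (x : E) (hx : x ∈ Metric.closedBall z ‖h‖) :
        ‖fderiv ℝ G x - fderiv ℝ G z‖ ≤ C * ‖h‖ := by
      refine (Convex.norm_image_sub_le_of_norm_fderiv_le (s := Metric.closedBall z ‖h‖) (𝕜 := ℝ)
        (fun y hy => ?_) (fun y hy => ?_) (convex_closedBall z _) hzb hx).trans
        (mul_le_mul_of_nonneg_left (a := C) ?_ (by positivity))
      · exact (h1.contDiffAt (hU.mem_nhds (hsub (hball hy)))).differentiableAt (by norm_num)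
      · exact (hC₂ y (hball hy)).trans ((le_max_right _ _).trans (le_max_right _ _))
      · exact mem_closedBall_iff_norm.1 hx
    have := Convex.norm_image_sub_le_of_norm_fderiv_le' (f := G) (φ := fderiv ℝ G z)
      (x := z) (y := z + h) (s := Metric.closedBall z ‖h‖) (𝕜 := ℝ)
      (fun y hy => (hG.contDiffAt (hU.mem_nhds (hsub (hball hy)))).differentiableAt (by norm_num))
      hlip (convex_closedBall z _) hzb (by simp)
    rw [add_sub_cancel_left] at this
    rw [← Real.norm_eq_abs]
    exact this.trans_eq (by ring)

lemma tendsto_atTop_of_div_rpow {s : ℕ → ℝ} {a : ℝ} (ha : 0 ≤ a) (hs0 : ∀ n, 0 ≤ s n)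
    (hs : Tendsto (fun n : ℕ => s n / (n : ℝ) ^ a) atTop atTop) : Tendsto s atTop atTop := by
  refine tendsto_atTop_mono' _ ?_ hs
  filter_upwards [eventually_ge_atTop 1] with n hn
  refine div_le_self (hs0 n) (Real.one_le_rpow (by exact_mod_cast hn) ha)

/-- The linear part is asymptotically normal. -/
lemma tendsto_measureReal_linear {ι : Type*} [Fintype ι] {W : ℕ → Ω → ι → ℝ}
    (hW : ∀ j, AEMeasurable (W j) P) (hind : iIndepFun W P) {q M Λ : ℝ} (hq : 2 < q)
    (hWq : ∀ j, Integrable (fun ω => ‖W j ω‖ ^ q) P) (hM : ∀ j, ∫ ω, ‖W j ω‖ ^ q ∂P ≤ M)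
    (L : ℕ → (ι → ℝ) →L[ℝ] ℝ) (h0 : ∀ n j, ∫ ω, L n (W j ω) ∂P = 0)
    (hL : ∀ᶠ n in atTop, ‖L n‖ ≤ Λ) {s : ℕ → ℝ}
    (hs : ∀ n, s n = √(∑ j ∈ Finset.range n, ∫ ω, L n (W j ω) ^ 2 ∂P))
    (hlim : Tendsto (fun n : ℕ => s n / (n : ℝ) ^ (1 / q)) atTop atTop) (u : ℝ) :
    Tendsto (fun n => P.real {ω | ∑ j ∈ Finset.range n, L n (W j ω) / (√2 * s n) ≤ u}) atTop
      (𝓝 (gaussPhi u)) := by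
  have hq0 : 0 < q := by linarith
  have hs0 (n) : 0 ≤ s n := by rw [hs]; positivity
  have hsT : Tendsto s atTop atTop := tendsto_atTop_of_div_rpow (by positivity) hs0 hlim
  have hLm (n j) : AEMeasurable (fun ω => L n (W j ω)) P :=
    (L n).continuous.measurable.comp_aemeasurable (hW j)
  have hLq (n j) : Integrable (fun ω => |L n (W j ω)| ^ q) P := by
    refine ((hWq j).const_mul (‖L n‖ ^ q)).mono' ?_ (ae_of_all _ fun ω => ?_)
    · exact ((hLm n j).norm.pow_const q).aestronglyMeasurable
    · rw [Real.norm_of_nonneg (by positivity), ← Real.mul_rpow (norm_nonneg _) (norm_nonneg _)]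
      exact Real.rpow_le_rpow (abs_nonneg _) ((L n).le_opNorm _) hq0.le
  have hLint (n j) : ∫ ω, |L n (W j ω)| ^ q ∂P ≤ ‖L n‖ ^ q * M := by
    calc _ ≤ ∫ ω, ‖L n‖ ^ q * ‖W j ω‖ ^ q ∂P := by
          refine integral_mono (hLq n j) ((hWq j).const_mul _) fun ω => ?_
          rw [← Real.mul_rpow (norm_nonneg _) (norm_nonneg _)]
          exact Real.rpow_le_rpow (abs_nonneg _) ((L n).le_opNorm _) hq0.le
      _ ≤ _ := by rw [integral_const_mul]; gcongr; exact hM j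
  refine tendsto_measureReal_le_of_tendsto_charFun
    (fun n => Finset.aemeasurable_fun_sum _ fun j _ => (hLm n j).div_const _) (fun t => ?_) u
  -- The argument `t` is moved into the summands, so that only characteristic functions at `1`
  -- occur; the variances then sum to `t² / 2` as soon as `s n > 0`.
  set Z : ℕ → ℕ → Ω → ℝ := fun n j ω => t / (√2 * s n) * L n (W j ω) with hZ
  have hT : Tendsto (fun n => charFun (P.map (fun ω => ∑ j ∈ Finset.range n, Z n j ω)) 1) atTop
      (𝓝 (Complex.exp (-((t ^ 2 / 2 : ℝ) : ℂ) / 2))) := by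
    refine tendsto_charFun_one_array hq (fun n j => (hLm n j).const_mul _) (fun n => ?_)
      (fun n j => ?_) (fun n j => ?_) ?_ ?_
    · exact hind.comp (fun _ w => t / (√2 * s n) * L n w)
        fun _ => ((L n).continuous.measurable.const_mul _)
    · have : (fun ω => |Z n j ω| ^ q) =
          fun ω => |t / (√2 * s n)| ^ q * |L n (W j ω)| ^ q := by
        ext ω
        rw [hZ, abs_mul, Real.mul_rpow (abs_nonneg _) (abs_nonneg _)]
      rw [this]
      exact (hLq n j).const_mul _
    · rw [hZ, integral_const_mul, h0, mul_zero]
    · refine tendsto_const_nhds.congr' ?_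
      filter_upwards [hsT.eventually_gt_atTop 0] with n hn
      have e : s n ^ 2 = ∑ j ∈ Finset.range n, ∫ ω, L n (W j ω) ^ 2 ∂P := by
        rw [hs n, Real.sq_sqrt]
        exact Finset.sum_nonneg fun j _ => integral_nonneg fun _ => sq_nonneg _
      simp only [hZ, mul_pow, integral_const_mul]
      rw [← Finset.mul_sum, ← e, div_pow, mul_pow, Real.sq_sqrt zero_le_two]
      field_simp
    -- The Lyapunov sum is at most a constant times `n / s_n^q = (s_n / n^(1/q))^(-q)`; here the
    -- growth of `s` is used in full.
    · have hbound : Tendsto (fun n : ℕ => (|t| ^ q * Λ ^ q * M / √2 ^ q) *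
          (s n / (n : ℝ) ^ (1 / q)) ^ (-q)) atTop (𝓝 0) := by
        simpa using ((tendsto_rpow_neg_atTop hq0).comp hlim).const_mul
          (|t| ^ q * Λ ^ q * M / √2 ^ q)
      refine squeeze_zero' (Eventually.of_forall fun n => Finset.sum_nonneg fun j _ =>
        integral_nonneg fun _ => by positivity) ?_ hbound
      filter_upwards [hL, hsT.eventually_gt_atTop 0, eventually_gt_atTop 0] with n hn hsn hn0
      have hn0' : (0 : ℝ) < n := by exact_mod_cast hn0
      have hM0 : 0 ≤ M := le_trans (integral_nonneg fun _ => by positivity) (hM 0)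
      calc _ ≤ ∑ j ∈ Finset.range n, |t / (√2 * s n)| ^ q * (Λ ^ q * M) := by
            refine Finset.sum_le_sum fun j _ => ?_
            have : (fun ω => |Z n j ω| ^ q) =
                fun ω => |t / (√2 * s n)| ^ q * |L n (W j ω)| ^ q := by
              ext ω
              rw [hZ, abs_mul, Real.mul_rpow (abs_nonneg _) (abs_nonneg _)]
            rw [this, integral_const_mul]
            refine mul_le_mul_of_nonneg_left ((hLint n j).trans ?_) (by positivity)
            gcongr
        _ = _ := by
            rw [Finset.sum_const, Finset.card_range, nsmul_eq_mul, abs_div,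
              abs_of_pos (by positivity : 0 < √2 * s n), Real.div_rpow (abs_nonneg _)
              (by positivity), Real.mul_rpow (by positivity) hsn.le,
              Real.div_rpow hsn.le (by positivity), ← Real.rpow_mul hn0'.le, Real.rpow_neg hsn.le]
            have : 1 / q * -q = -1 := by field_simp
            rw [this, Real.rpow_neg_one]
            field_simp
  have e : Complex.exp (-(t : ℂ) ^ 2 / 4) = Complex.exp (-((t ^ 2 / 2 : ℝ) : ℂ) / 2) := by
    congr 1; push_cast; ring
  rw [e]
  refine hT.congr fun n => ?_
  have e2 : (fun ω => ∑ j ∈ Finset.range n, Z n j ω) =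
      fun ω => t * ∑ j ∈ Finset.range n, L n (W j ω) / (√2 * s n) := by
    ext ω
    rw [Finset.mul_sum]
    exact Finset.sum_congr rfl fun j _ => by rw [hZ]; ring
  rw [e2, charFun_map_mul_comp]
  · simp
  · exact Finset.aemeasurable_fun_sum _ fun j _ => (hLm n j).div_const _

/-- Asymptotic normality of a smooth function of the mean of independent random vectors: the
point of expansion `r n` may vary with `n` in a compact set. -/
theorem tendstoUniformly_smooth_mean {ι : Type*} [Fintype ι] {W : ℕ → Ω → ι → ℝ}
    (hW : ∀ j, AEMeasurable (W j) P) (hind : iIndepFun W P) {q M : ℝ} (hq : 2 < q)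
    (hWq : ∀ j, Integrable (fun ω => ‖W j ω‖ ^ q) P) (hM : ∀ j, ∫ ω, ‖W j ω‖ ^ q ∂P ≤ M)
    (h0 : ∀ j, ∫ ω, W j ω ∂P = 0)
    {G : (ι → ℝ) → ℝ} {U K : Set (ι → ℝ)} (hU : IsOpen U) (hK : IsCompact K) (hKU : K ⊆ U)
    (hG : ContDiffOn ℝ 2 G U) {r : ℕ → ι → ℝ} (hr : ∀ᶠ n in atTop, r n ∈ K) {s : ℕ → ℝ}
    (hs : ∀ n, s n = √(∑ j ∈ Finset.range n, ∫ ω, fderiv ℝ G (r n) (W j ω) ^ 2 ∂P))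
    (hlim : Tendsto (fun n : ℕ => s n / (n : ℝ) ^ (1 / q)) atTop atTop) :
    TendstoUniformly (fun (n : ℕ) (u : ℝ) => P.real {ω | n / (√2 * s n) *
      (G (r n + (n : ℝ)⁻¹ • ∑ j ∈ Finset.range n, W j ω) - G (r n)) ≤ u}) gaussPhi atTop := by
  have hq0 : 0 < q := by linarith
  obtain ⟨ρ, hρ, C, hC, hT⟩ := exists_taylor_bound hU hK hKU hG
  have hs0 (n) : 0 ≤ s n := by rw [hs]; positivity
  have hsT : Tendsto s atTop atTop := tendsto_atTop_of_div_rpow (by positivity) hs0 hlim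
  have hWm (j β) : AEMeasurable (fun ω => W j ω β) P :=
    (measurable_pi_apply β).comp_aemeasurable (hW j)
  have hL2n (j) : MemLp (fun ω => ‖W j ω‖) 2 P :=
    integrable_sq_of_integrable_rpow hq.le (hW j).norm (by simpa using hWq j)
  have hL2 (j β) : MemLp (fun ω => W j ω β) 2 P :=
    (hL2n j).mono (hWm j β).aestronglyMeasurable (ae_of_all _ fun ω => by
      rw [norm_norm]; exact norm_le_pi_norm _ β)
  have hWi (j) : Integrable (W j) P := by
    rw [← integrable_norm_iff (hW j).aestronglyMeasurable]
    exact (hL2n j).integrable (by norm_num)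
  have h0c (j β) : ∫ ω, W j ω β ∂P = 0 := by
    have := (ContinuousLinearMap.proj (R := ℝ) (φ := fun _ : ι => ℝ) β).integral_comp_comm (hWi j)
    simpa [h0 j] using this
  have h0L (n j) : ∫ ω, fderiv ℝ G (r n) (W j ω) ∂P = 0 := by
    rw [ContinuousLinearMap.integral_comp_comm _ (hWi j), h0 j, map_zero]
  have hB (j β) : ∫ ω, W j ω β ^ 2 ∂P ≤ 1 + M := by
    calc _ ≤ ∫ ω, (1 + ‖W j ω‖ ^ q) ∂P := by
          refine integral_mono (hL2 j β).integrable_sq ((integrable_const _).add (hWq j)) fun ω => ?_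
          have h1 : W j ω β ^ 2 ≤ ‖W j ω‖ ^ 2 := by
            rw [← sq_abs]
            exact pow_le_pow_left₀ (abs_nonneg _) (norm_le_pi_norm (W j ω) β) 2
          refine h1.trans ?_
          rcases le_total ‖W j ω‖ 1 with h | h
          · have : ‖W j ω‖ ^ 2 ≤ 1 := pow_le_one₀ (norm_nonneg _) h
            have : 0 ≤ ‖W j ω‖ ^ q := by positivity
            linarith
          · have : ‖W j ω‖ ^ (2 : ℝ) ≤ ‖W j ω‖ ^ q := Real.rpow_le_rpow_of_exponent_le h hq.le
            rw [Real.rpow_two] at this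
            linarith
      _ ≤ _ := by
          rw [integral_add (integrable_const _) (hWq j)]
          simpa using hM j
  have hlin := tendsto_measureReal_linear hW hind hq hWq hM (fun n => fderiv ℝ G (r n)) h0L
    (hr.mono fun n hn => (hT _ hn).1) hs hlim
  refine tendstoUniformly_of_monotone (fun n a b hab => measureReal_mono fun ω hω =>
    le_trans (b := a) hω hab) (fun _ _ => measureReal_nonneg) (fun _ _ => measureReal_le_one)
    continuous_gaussPhi monotone_gaussPhi tendsto_gaussPhi_atBot tendsto_gaussPhi_atTop fun u => ?_
  refine tendsto_measureReal_le_of_abs_sub continuous_gaussPhi hlin (fun η hη => ?_) u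
  set B := Fintype.card ι * (1 + M) with hBdef
  -- The first term bounds the probability that `Δ` leaves the Taylor radius `ρ`, the second that
  -- the scaled remainder `a * C * ‖Δ‖²` reaches `η`.
  have hzero : Tendsto (fun n : ℕ => B / n / ρ ^ 2 + B * C / (η * √2) * (s n)⁻¹) atTop (𝓝 0) := by
    have h1 : Tendsto (fun n : ℕ => B / (n : ℝ) / ρ ^ 2) atTop (𝓝 0) := by
      simpa using (tendsto_const_div_atTop_nhds_zero_nat B).div_const (ρ ^ 2)
    have h2 : Tendsto (fun n => B * C / (η * √2) * (s n)⁻¹) atTop (𝓝 0) := by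
      simpa using hsT.inv_tendsto_atTop.const_mul (B * C / (η * √2))
    simpa using h1.add h2
  refine squeeze_zero' (Eventually.of_forall fun n => measureReal_nonneg) ?_ hzero
  filter_upwards [hr, hsT.eventually_gt_atTop 0, eventually_gt_atTop 0] with n hrn hsn hn
  have hn' : (0 : ℝ) < n := by exact_mod_cast hn
  have ha : 0 < n / (√2 * s n) := by positivity
  set a := n / (√2 * s n) with hadef
  have c1 := measureReal_le_norm_mean_sq hind hL2 h0c hB hn.ne' (c := ρ ^ 2) (by positivity)
  have c2 := measureReal_le_norm_mean_sq hind hL2 h0c hB hn.ne' (c := η / (a * C)) (by positivity)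
  refine ((measureReal_mono ?_).trans (measureReal_union_le _ _)).trans
    ((add_le_add c1 c2).trans_eq ?_)
  · intro ω (hω : η < _)
    by_contra hcon
    simp only [Set.mem_union, Set.mem_ofPred_eq, not_or, not_le] at hcon
    obtain ⟨g1, g2⟩ := hcon
    set Δ := (n : ℝ)⁻¹ • ∑ j ∈ Finset.range n, W j ω with hΔ
    have hΔρ : ‖Δ‖ ≤ ρ := (lt_of_pow_lt_pow_left₀ 2 hρ.le g1).le
    have hrem := (hT _ hrn).2 Δ hΔρ
    have e : ∑ j ∈ Finset.range n, fderiv ℝ G (r n) (W j ω) / (√2 * s n) =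
        a * fderiv ℝ G (r n) Δ := by
      rw [hΔ, map_smul, map_sum, ← Finset.sum_div, smul_eq_mul, hadef]
      field_simp
    rw [e, ← mul_sub, abs_mul, abs_of_pos ha] at hω
    rw [lt_div_iff₀ (by positivity)] at g2
    have := mul_le_mul_of_nonneg_left hrem ha.le
    linarith
  · rw [hadef, hBdef]
    field_simp

end Convergence

/-! ### Moments from tail bounds -/

section Tail

variable {k : ℕ} {V : ℕ → Measure (Fin k → ℝ)} [∀ ν, IsProbabilityMeasure (V ν)]
  {N : Fin k → ℝ} {C p : ℝ}

lemma UniformTail.measure_lt_abs_le (h : UniformTail V N C p) (hN : ∀ i, 0 < N i) (ν : ℕ)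
    (i : Fin k) {t : ℝ} (ht : N i < t) :
    V ν {x | t < |x i|} ≤ 2 * ENNReal.ofReal (C * t ^ (-p)) := by
  have ht0 : 0 < t := (hN i).trans ht
  have hm : Measurable fun x : Fin k → ℝ => x i := measurable_pi_apply i
  have := Measure.isProbabilityMeasure_map (μ := V ν) hm.aemeasurable
  set μ := (V ν).map fun x => x i with hμ
  have h1 : μ (Set.Iic (-t)) ≤ ENNReal.ofReal (C * t ^ (-p)) := by
    rw [← ofReal_cdf]
    have := (h ν i (-t)).1 (by linarith)
    rw [abs_neg, abs_of_pos ht0] at this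
    exact ENNReal.ofReal_le_ofReal this
  have h2 : μ (Set.Ioi t) ≤ ENNReal.ofReal (C * t ^ (-p)) := by
    have := (h ν i t).2 ht
    rw [abs_of_pos ht0] at this
    rw [← Set.compl_Iic, prob_compl_eq_one_sub measurableSet_Iic, ← ofReal_cdf,
      ← ENNReal.ofReal_one, ← ENNReal.ofReal_sub _ (cdf_nonneg _ _)]
    exact ENNReal.ofReal_le_ofReal this
  calc V ν {x | t < |x i|} ≤ V ν ((fun x => x i) ⁻¹' (Set.Iic (-t) ∪ Set.Ioi t)) := by
        refine measure_mono fun x (hx : t < |x i|) => ?_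
        rcases lt_abs.1 hx with h | h
        · exact Or.inr h
        · left; change x i ≤ -t; linarith
    _ = μ (Set.Iic (-t) ∪ Set.Ioi t) :=
        (Measure.map_apply hm (measurableSet_Iic.union measurableSet_Ioi)).symm
    _ ≤ _ := (measure_union_le _ _).trans ((add_le_add h1 h2).trans_eq (two_mul _).symm)

/-- Layer-cake formula: tail probabilities are bounded by `1` up to `N i` and by the hypothesis
beyond, where `s < p` gives integrability. The bound does not involve `ν`. -/
lemma UniformTail.exists_moment_bound (h : UniformTail V N C p) (hN : ∀ i, 0 < N i) {s : ℝ}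
    (hs : 0 < s) (hsp : s < p) (i : Fin k) :
    ∃ M : ℝ, ∀ ν, Integrable (fun x : Fin k → ℝ => |x i| ^ s) (V ν) ∧
      ∫ x, |x i| ^ s ∂(V ν) ≤ M := by
  set A : ℝ≥0∞ := (∫⁻ t in Set.Ioc 0 (N i), ENNReal.ofReal (t ^ (s - 1))) +
    ∫⁻ t in Set.Ioi (N i), 2 * ENNReal.ofReal (C * t ^ (s - 1 - p)) with hA
  have hA1 : ∫⁻ t in Set.Ioc 0 (N i), ENNReal.ofReal (t ^ (s - 1)) < ∞ := by
    have := (intervalIntegral.intervalIntegrable_rpow' (a := 0) (b := N i)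
      (by linarith : -1 < s - 1)).1
    exact this.lintegral_lt_top
  have hA2 : ∫⁻ t in Set.Ioi (N i), 2 * ENNReal.ofReal (C * t ^ (s - 1 - p)) < ∞ := by
    rw [lintegral_const_mul' _ _ (by simp)]
    refine ENNReal.mul_lt_top (by simp) ?_
    have := (integrableOn_Ioi_rpow_of_lt (by linarith : s - 1 - p < -1) (hN i)).const_mul C
    exact this.lintegral_lt_top
  have hAtop : ENNReal.ofReal s * A ≠ ∞ :=
    ENNReal.mul_ne_top ENNReal.ofReal_ne_top (ENNReal.add_lt_top.2 ⟨hA1, hA2⟩).ne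
  have hm : Measurable fun x : Fin k → ℝ => |x i| := by fun_prop
  have hle (ν) : ∫⁻ x, ENNReal.ofReal (|x i| ^ s) ∂(V ν) ≤ ENNReal.ofReal s * A := by
    rw [lintegral_rpow_eq_lintegral_meas_lt_mul _ (ae_of_all _ fun x => abs_nonneg _)
      hm.aemeasurable hs]
    refine mul_le_mul_right ?_ _
    rw [← Set.Ioc_union_Ioi_eq_Ioi (hN i).le]
    refine (lintegral_union_le _ _ _).trans (add_le_add ?_ ?_)
    · refine setLIntegral_mono' measurableSet_Ioc fun t _ => ?_
      exact mul_le_of_le_one_left zero_le prob_le_one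
    · refine setLIntegral_mono' measurableSet_Ioi fun t (ht : N i < t) => ?_
      have ht0 : 0 < t := (hN i).trans ht
      refine (mul_le_mul_left (h.measure_lt_abs_le hN ν i ht) _).trans_eq ?_
      rw [mul_assoc, ← ENNReal.ofReal_mul' (by positivity), mul_assoc, ← Real.rpow_add ht0]
      congr 4
      ring
  refine ⟨(ENNReal.ofReal s * A).toReal, fun ν => ⟨⟨?_, ?_⟩, ?_⟩⟩
  · exact (hm.pow_const s).aestronglyMeasurable
  · rw [hasFiniteIntegral_iff_ofReal (ae_of_all _ fun x => by positivity)]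
    exact (hle ν).trans_lt hAtop.lt_top
  · rw [integral_eq_lintegral_of_nonneg_ae (ae_of_all _ fun x => by positivity)
      (hm.pow_const s).aestronglyMeasurable]
    exact ENNReal.toReal_mono hAtop (hle ν)

end Tail

/-! ### Monomials and the reduction to moments about zero -/

lemma max_one_norm_rpow_le {k : ℕ} (y : Fin k → ℝ) {s : ℝ} (hs : 0 ≤ s) :
    max 1 ‖y‖ ^ s ≤ 1 + ∑ i, |y i| ^ s := by
  have hsum : 0 ≤ ∑ i, |y i| ^ s := Finset.sum_nonneg fun _ _ => by positivity
  rcases le_or_gt ‖y‖ 1 with h | h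
  · rw [max_eq_left h, Real.one_rpow]
    linarith
  · rw [max_eq_right h.le]
    obtain ⟨i, hi⟩ : ∃ i, ‖y‖ ≤ |y i| := by
      by_contra! hcon
      exact lt_irrefl _ ((pi_norm_lt_iff (by linarith)).2 hcon)
    calc ‖y‖ ^ s ≤ |y i| ^ s := Real.rpow_le_rpow (norm_nonneg _) hi hs
      _ ≤ ∑ i, |y i| ^ s := Finset.single_le_sum (f := fun i => |y i| ^ s)
          (fun _ _ => by positivity) (Finset.mem_univ i)
      _ ≤ _ := by linarith

/-- The multi-indices of order at most `m`. -/
def multiIndices (k m : ℕ) : Finset (Fin k → ℕ) :=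
  (Fintype.piFinset fun _ => Finset.range (m + 1)).filter fun β => ∑ i, β i ≤ m

lemma mem_multiIndices {k m : ℕ} {β : Fin k → ℕ} : β ∈ multiIndices k m ↔ ∑ i, β i ≤ m := by
  simp only [multiIndices, Finset.mem_filter, Fintype.mem_piFinset, Finset.mem_range,
    and_iff_right_iff_imp]
  intro h i
  exact Nat.lt_succ_of_le ((Finset.single_le_sum (fun _ _ => Nat.zero_le _)
    (Finset.mem_univ i)).trans h)

/-- The vector of all monomials of order at most `m`. -/
def monomialVector (k m : ℕ) (y : Fin k → ℝ) : multiIndices k m → ℝ :=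
  fun β => ∏ i, y i ^ β.1 i

lemma continuous_monomialVector (k m : ℕ) : Continuous (monomialVector k m) := by
  unfold monomialVector
  fun_prop

lemma norm_monomialVector_le {k m : ℕ} (y : Fin k → ℝ) :
    ‖monomialVector k m y‖ ≤ max 1 ‖y‖ ^ m := by
  rw [pi_norm_le_iff_of_nonneg (by positivity)]
  intro β
  rw [monomialVector, norm_prod]
  calc _ ≤ ∏ i, max 1 ‖y‖ ^ β.1 i := by
        refine Finset.prod_le_prod (fun _ _ => norm_nonneg _) fun i _ => ?_
        rw [norm_pow]
        exact pow_le_pow_left₀ (norm_nonneg _) ((norm_le_pi_norm y i).trans (le_max_right _ _)) _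
    _ = max 1 ‖y‖ ^ ∑ i, β.1 i := Finset.prod_pow_eq_pow_sum _ _ _
    _ ≤ _ := pow_le_pow_right₀ (le_max_left _ _) (mem_multiIndices.1 β.2)

lemma norm_monomialVector_rpow_le {k m : ℕ} (y : Fin k → ℝ) {q : ℝ} (hq : 0 ≤ q) :
    ‖monomialVector k m y‖ ^ q ≤ 1 + ∑ i, |y i| ^ (m * q) := by
  calc _ ≤ (max 1 ‖y‖ ^ m) ^ q := Real.rpow_le_rpow (norm_nonneg _) (norm_monomialVector_le y) hq
    _ = max 1 ‖y‖ ^ (m * q) := by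
        rw [Real.rpow_mul (by positivity), Real.rpow_natCast]
    _ ≤ _ := max_one_norm_rpow_le y (by positivity)

lemma integrable_monomialVector {k m : ℕ} {W : Measure (Fin k → ℝ)} (hW : W ∈ finiteMoment k m) :
    Integrable (monomialVector k m) W := by
  have := hW.1
  refine Integrable.mono' ((integrable_const 1).add (integrable_finsetSum Finset.univ
    fun i _ => hW.2 i)) (continuous_monomialVector k m).aestronglyMeasurable
    (ae_of_all _ fun y => ?_)
  have := norm_monomialVector_rpow_le (m := m) y zero_le_one
  simpa using this

/-- The entry with multi-index `β`, or `0` if `β` has order larger than `m`. -/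
def entry {k m : ℕ} (r : multiIndices k m → ℝ) (β : Fin k → ℕ) : ℝ :=
  if h : β ∈ multiIndices k m then r ⟨β, h⟩ else 0

lemma contDiff_entry {k m : ℕ} (β : Fin k → ℕ) :
    ContDiff ℝ 2 fun r : multiIndices k m → ℝ => entry r β := by
  unfold entry
  split_ifs
  · fun_prop
  · fun_prop

lemma entry_integral {k m : ℕ} {W : Measure (Fin k → ℝ)} (hW : W ∈ finiteMoment k m)
    {β : Fin k → ℕ} (hβ : ∑ i, β i ≤ m) :
    entry (∫ y, monomialVector k m y ∂W) β = ∫ y, ∏ i, y i ^ β i ∂W := by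
  rw [entry, dif_pos (mem_multiIndices.2 hβ), eval_integral]
  · rfl
  · exact fun i => (integrable_monomialVector hW).eval i

lemma integrable_monomial {k m : ℕ} {W : Measure (Fin k → ℝ)} (hW : W ∈ finiteMoment k m)
    {β : Fin k → ℕ} (hβ : ∑ i, β i ≤ m) : Integrable (fun y => ∏ i, y i ^ β i) W :=
  (integrable_monomialVector hW).eval ⟨β, mem_multiIndices.2 hβ⟩

/-- The polynomial map that expresses means and central moments by the moments about `0`. -/
def momentMap {k d m : ℕ} (index : Fin d → Fin k → ℕ) (r : multiIndices k m → ℝ) :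
    (Fin k → ℝ) × (Fin d → ℝ) :=
  (fun i => entry r (Pi.single i 1),
    fun j => ∑ β ∈ Fintype.piFinset fun i => Finset.range (index j i + 1),
      (∏ i, (-entry r (Pi.single i 1)) ^ (index j i - β i) * ((index j i).choose (β i) : ℝ)) *
        entry r β)

lemma contDiff_momentMap {k d m : ℕ} (index : Fin d → Fin k → ℕ) :
    ContDiff ℝ 2 (momentMap (m := m) index) := by
  refine ContDiff.prodMk (contDiff_pi.2 fun i => contDiff_entry _) (contDiff_pi.2 fun j => ?_)
  refine ContDiff.sum fun β _ => ContDiff.mul (contDiff_prod fun i _ => ?_) (contDiff_entry _)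
  exact ((contDiff_entry _).neg.pow _).mul contDiff_const

lemma prod_sub_pow {ι : Type*} [Fintype ι] [DecidableEq ι] (x a : ι → ℝ) (ν : ι → ℕ) :
    ∏ i, (x i - a i) ^ ν i = ∑ β ∈ Fintype.piFinset fun i => Finset.range (ν i + 1),
      (∏ i, (-a i) ^ (ν i - β i) * ((ν i).choose (β i) : ℝ)) * ∏ i, x i ^ β i := by
  simp_rw [sub_eq_add_neg, add_pow]
  rw [Finset.prod_univ_sum]
  refine Finset.sum_congr rfl fun β _ => ?_
  rw [← Finset.prod_mul_distrib]
  exact Finset.prod_congr rfl fun i _ => by ring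

/-- Binomial expansion produces only monomials of order at most `m`, all integrable; `1 ≤ m` puts
the coordinates themselves among them. -/
lemma momentVector_eq_momentMap {k d m : ℕ} (hm : 1 ≤ m) {index : Fin d → Fin k → ℕ}
    (hindex : ∀ j, ∑ i, index j i ≤ m) {W : Measure (Fin k → ℝ)} (hW : W ∈ finiteMoment k m) :
    momentVector index W = momentMap index (∫ y, monomialVector k m y ∂W) := by
  have hmean (i : Fin k) :
      entry (∫ y, monomialVector k m y ∂W) (Pi.single i 1) = mean W i := by
    rw [entry_integral hW (by simpa using hm), mean]
    congr 1
    ext y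
    rw [Finset.prod_eq_single i (fun j _ hj => by simp [hj]) (by simp)]
    simp
  have hβ {j : Fin d} {β : Fin k → ℕ}
      (h : β ∈ Fintype.piFinset fun i => Finset.range (index j i + 1)) : ∑ i, β i ≤ m :=
    (Finset.sum_le_sum fun i _ => Nat.lt_succ_iff.1
      (Finset.mem_range.1 (Fintype.mem_piFinset.1 h i))).trans (hindex j)
  refine Prod.ext (funext fun i => (hmean i).symm) (funext fun j => ?_)
  simp only [momentVector, momentMap, moment, hmean]
  simp_rw [prod_sub_pow]
  rw [integral_finsetSum _ fun β h => (integrable_monomial hW (hβ h)).const_mul _]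
  refine Finset.sum_congr rfl fun β h => ?_
  rw [integral_const_mul, entry_integral hW (hβ h)]

/-! ### Averages and segments of measures -/

section Average

variable {E : Type*} [MeasurableSpace E] {F : Type*} [NormedAddCommGroup F]

lemma integrable_avgDist {V : ℕ → Measure E} {φ : E → F} (hφ : ∀ j, Integrable φ (V j)) {n : ℕ}
    (hn : n ≠ 0) : Integrable φ (avgDist V n) :=
  (integrable_finsetSum_measure.2 fun j _ => hφ j).smul_measure (by simp [hn])

lemma integral_avgDist [NormedSpace ℝ F] {V : ℕ → Measure E} {φ : E → F}
    (hφ : ∀ j, Integrable φ (V j)) (n : ℕ) :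
    ∫ y, φ y ∂(avgDist V n) = (n : ℝ)⁻¹ • ∑ j ∈ Finset.range n, ∫ y, φ y ∂(V j) := by
  rw [avgDist, integral_smul_measure, integral_finsetSum_measure fun j _ => hφ j]
  simp

lemma isProbabilityMeasure_avgDist {V : ℕ → Measure E} [∀ j, IsProbabilityMeasure (V j)] {n : ℕ}
    (hn : n ≠ 0) : IsProbabilityMeasure (avgDist V n) := by
  refine ⟨?_⟩
  simp only [avgDist, Measure.smul_apply, Measure.coe_finsetSum, Finset.sum_apply, measure_univ,
    Finset.sum_const, Finset.card_range, smul_eq_mul, nsmul_eq_mul, mul_one]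
  exact ENNReal.inv_mul_cancel (by simp [hn]) (by simp)

lemma integrable_segmentPoint {V₁ V : Measure E} {φ : E → F} (h₁ : Integrable φ V₁)
    (h : Integrable φ V) (t : ℝ) : Integrable φ (segmentPoint V₁ V t) :=
  (h₁.smul_measure ENNReal.ofReal_ne_top).add_measure (h.smul_measure ENNReal.ofReal_ne_top)

lemma integral_segmentPoint [NormedSpace ℝ F] {V₁ V : Measure E} {φ : E → F} (h₁ : Integrable φ V₁)
    (h : Integrable φ V) {t : ℝ} (ht : t ∈ Set.Icc (0 : ℝ) 1) :
    ∫ y, φ y ∂(segmentPoint V₁ V t) =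
      ∫ y, φ y ∂V₁ + t • (∫ y, φ y ∂V - ∫ y, φ y ∂V₁) := by
  rw [segmentPoint, integral_add_measure (h₁.smul_measure ENNReal.ofReal_ne_top)
    (h.smul_measure ENNReal.ofReal_ne_top), integral_smul_measure, integral_smul_measure,
    ENNReal.toReal_ofReal ht.1, ENNReal.toReal_ofReal (sub_nonneg.2 ht.2)]
  module

lemma isProbabilityMeasure_segmentPoint {V₁ V : Measure E} [IsProbabilityMeasure V₁]
    [IsProbabilityMeasure V] {t : ℝ} (ht : t ∈ Set.Icc (0 : ℝ) 1) :
    IsProbabilityMeasure (segmentPoint V₁ V t) := by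
  refine ⟨?_⟩
  simp only [segmentPoint, Measure.add_apply, Measure.smul_apply, measure_univ, smul_eq_mul,
    mul_one]
  rw [← ENNReal.ofReal_add (sub_nonneg.2 ht.2) ht.1]
  simp

end Average

/-! ### Derivatives of functions of moments -/

section FiniteMoment

variable {k m : ℕ}

lemma dirac_mem_finiteMoment (y : Fin k → ℝ) : Measure.dirac y ∈ finiteMoment k m :=
  ⟨inferInstance, fun _ => integrable_dirac (by simp)⟩

lemma avgDist_mem_finiteMoment {V : ℕ → Measure (Fin k → ℝ)}
    (hV : ∀ j, V j ∈ finiteMoment k m) {n : ℕ} (hn : n ≠ 0) : avgDist V n ∈ finiteMoment k m :=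
  have := fun j => (hV j).1
  ⟨isProbabilityMeasure_avgDist hn, fun i => integrable_avgDist (fun j => (hV j).2 i) hn⟩

lemma segmentPoint_mem_finiteMoment {V₁ V : Measure (Fin k → ℝ)} (h₁ : V₁ ∈ finiteMoment k m)
    (h : V ∈ finiteMoment k m) {t : ℝ} (ht : t ∈ Set.Icc (0 : ℝ) 1) :
    segmentPoint V₁ V t ∈ finiteMoment k m :=
  have := h₁.1
  have := h.1
  ⟨isProbabilityMeasure_segmentPoint ht, fun i => integrable_segmentPoint (h₁.2 i) (h.2 i) t⟩

/-- A function of the moments about `0` is differentiable wherever its defining function is. -/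
lemma hasStatDeriv_of_moments {f : Measure (Fin k → ℝ) → ℝ} {G : (multiIndices k m → ℝ) → ℝ}
    (hf : ∀ W ∈ finiteMoment k m, f W = G (∫ y, monomialVector k m y ∂W))
    {V₁ : Measure (Fin k → ℝ)} (h₁ : V₁ ∈ finiteMoment k m)
    (hG : DifferentiableAt ℝ G (∫ y, monomialVector k m y ∂V₁)) :
    HasStatDeriv (finiteMoment k m) f V₁
      fun y => fderiv ℝ G (∫ y, monomialVector k m y ∂V₁) (monomialVector k m y) := by
  refine ⟨h₁, fun V hV => ?_⟩
  set r := ∫ y, monomialVector k m y ∂V₁ with hr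
  set L := fderiv ℝ G r with hL
  have i₁ := integrable_monomialVector h₁
  have i := integrable_monomialVector hV
  refine ⟨L.integrable_comp i, ?_⟩
  rw [L.integral_comp_comm i, L.integral_comp_comm i₁, ← map_sub, ← hr]
  set v := ∫ y, monomialVector k m y ∂V - r with hv
  -- Integration is affine along the segment, so the moment vector moves on a straight line and the
  -- chain rule applies.
  have hline : HasDerivWithinAt (fun t : ℝ => r + t • v) v (Set.Icc 0 1) 0 := by
    simpa using (((hasDerivAt_id (0 : ℝ)).smul_const v).const_add r).hasDerivWithinAt
  have hGr : HasFDerivAt G L (r + (0 : ℝ) • v) := by simpa using hG.hasFDerivAt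
  refine (hGr.comp_hasDerivWithinAt (0 : ℝ) hline).congr_of_mem (fun t ht => ?_) (by simp)
  rw [hf _ (segmentPoint_mem_finiteMoment h₁ hV ht), integral_segmentPoint i₁ i ht]
  rfl

/-- Derivatives are unique up to an additive constant. -/
lemma HasStatDeriv.exists_eq_add_const {f : Measure (Fin k → ℝ) → ℝ} {V₁ : Measure (Fin k → ℝ)}
    {g h : (Fin k → ℝ) → ℝ} (hg : HasStatDeriv (finiteMoment k m) f V₁ g)
    (hh : HasStatDeriv (finiteMoment k m) f V₁ h) : ∃ c : ℝ, ∀ y, h y = g y + c := by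
  refine ⟨∫ y, h y ∂V₁ - ∫ y, g y ∂V₁, fun y => ?_⟩
  -- The derivative towards the Dirac measure at `y` is `g y - ∫ g dV₁`.
  have e := (uniqueDiffOn_Icc_zero_one 0 (by simp)).eq_deriv _
    (hg.2 _ (dirac_mem_finiteMoment y)).2 (hh.2 _ (dirac_mem_finiteMoment y)).2
  rw [integral_dirac, integral_dirac] at e
  linarith

lemma UniformTail.mem_finiteMoment {V : ℕ → Measure (Fin k → ℝ)}
    [hV : ∀ ν, IsProbabilityMeasure (V ν)] {N : Fin k → ℝ} {C p : ℝ} (h : UniformTail V N C p)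
    (hN : ∀ i, 0 < N i) (hm : 1 ≤ m) (hp : m < p) (ν : ℕ) : V ν ∈ finiteMoment k m := by
  refine ⟨hV ν, fun i => ?_⟩
  obtain ⟨M, hM⟩ := h.exists_moment_bound hN (s := m) (by exact_mod_cast hm) hp i
  simpa using (hM ν).1

lemma UniformTail.exists_monomialVector_bound {V : ℕ → Measure (Fin k → ℝ)}
    [∀ ν, IsProbabilityMeasure (V ν)] {N : Fin k → ℝ} {C p : ℝ} (h : UniformTail V N C p)
    (hN : ∀ i, 0 < N i) (hm : 1 ≤ m) {q : ℝ} (hq : 0 < q) (hp : m * q < p) :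
    ∃ M : ℝ, ∀ ν, Integrable (fun y => ‖monomialVector k m y‖ ^ q) (V ν) ∧
      ∫ y, ‖monomialVector k m y‖ ^ q ∂(V ν) ≤ M := by
  have hm' : (0 : ℝ) < m := by exact_mod_cast hm
  choose M hM using fun i => h.exists_moment_bound hN (s := m * q) (by positivity) hp i
  have hi (ν) : Integrable (fun y : Fin k → ℝ => 1 + ∑ i, |y i| ^ (m * q)) (V ν) :=
    (integrable_const 1).add (integrable_finsetSum _ fun i _ => (hM i ν).1)
  have hi' (ν) : Integrable (fun y => ‖monomialVector k m y‖ ^ q) (V ν) := by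
    refine (hi ν).mono' ?_ (ae_of_all _ fun y => ?_)
    · exact ((continuous_monomialVector k m).norm.measurable.pow_const q).aestronglyMeasurable
    · rw [Real.norm_of_nonneg (by positivity)]
      exact norm_monomialVector_rpow_le y hq.le
  refine ⟨1 + ∑ i, M i, fun ν => ⟨hi' ν, ?_⟩⟩
  calc _ ≤ ∫ y : Fin k → ℝ, (1 + ∑ i, |y i| ^ (m * q)) ∂(V ν) :=
        integral_mono (hi' ν) (hi ν) fun y => norm_monomialVector_rpow_le y hq.le
    _ = 1 + ∑ i, ∫ y : Fin k → ℝ, |y i| ^ (m * q) ∂(V ν) := by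
        rw [integral_add (integrable_const 1) (integrable_finsetSum _ fun i _ => (hM i ν).1),
          integral_finsetSum _ fun i _ => (hM i ν).1]
        simp
    _ ≤ _ := by gcongr with i; exact (hM i ν).2

end FiniteMoment

/-! ### Centring and the dispersion -/

lemma add_rpow_le_two_rpow_mul {a b q : ℝ} (ha : 0 ≤ a) (hb : 0 ≤ b) (hq : 0 ≤ q) :
    (a + b) ^ q ≤ 2 ^ q * (a ^ q + b ^ q) := by
  have key {a b : ℝ} (ha : 0 ≤ a) (hb : 0 ≤ b) (hab : a ≤ b) :
      (a + b) ^ q ≤ 2 ^ q * (a ^ q + b ^ q) := by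
    calc (a + b) ^ q ≤ (2 * b) ^ q := Real.rpow_le_rpow (by positivity) (by linarith) hq
      _ = 2 ^ q * b ^ q := Real.mul_rpow zero_le_two hb
      _ ≤ _ := by gcongr; exact le_add_of_nonneg_left (by positivity)
  rcases le_total a b with h | h
  · exact key ha hb h
  · rw [add_comm a b, add_comm (a ^ q)]
    exact key hb ha h

/-- The centred random vectors `φ(X) - E φ(X)` inherit a moment bound from `φ(X)`. -/
lemma integrable_and_integral_norm_sub_rpow_le {Ω F : Type*} [MeasurableSpace Ω]
    [NormedAddCommGroup F] [NormedSpace ℝ F] {P : Measure Ω} [IsProbabilityMeasure P] {Y : Ω → F}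
    (hY : Integrable Y P) {q M : ℝ} (hq : 1 ≤ q) (hYq : Integrable (fun ω => ‖Y ω‖ ^ q) P)
    (hM : ∫ ω, ‖Y ω‖ ^ q ∂P ≤ M) :
    ‖∫ ω, Y ω ∂P‖ ≤ 1 + M ∧ Integrable (fun ω => ‖Y ω - ∫ ω, Y ω ∂P‖ ^ q) P ∧
      ∫ ω, ‖Y ω - ∫ ω, Y ω ∂P‖ ^ q ∂P ≤ 2 ^ q * (M + (1 + M) ^ q) := by
  have hq0 : 0 ≤ q := by linarith
  set a := ∫ ω, Y ω ∂P with ha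
  have hi1 : Integrable (fun ω => 1 + ‖Y ω‖ ^ q) P := (integrable_const 1).add hYq
  have haM : ‖a‖ ≤ 1 + M := by
    calc ‖a‖ ≤ ∫ ω, (1 + ‖Y ω‖ ^ q) ∂P := by
          refine norm_integral_le_of_norm_le hi1 (ae_of_all _ fun ω => ?_)
          rcases le_total ‖Y ω‖ 1 with h | h
          · have : 0 ≤ ‖Y ω‖ ^ q := by positivity
            linarith
          · have := Real.rpow_le_rpow_of_exponent_le h hq
            rw [Real.rpow_one] at this
            linarith
      _ ≤ 1 + M := by
          rw [integral_add (integrable_const 1) hYq]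
          simpa using hM
  have hi2 : Integrable (fun ω => 2 ^ q * (‖Y ω‖ ^ q + ‖a‖ ^ q)) P :=
    (hYq.add (integrable_const _)).const_mul _
  have hle (ω) : ‖Y ω - a‖ ^ q ≤ 2 ^ q * (‖Y ω‖ ^ q + ‖a‖ ^ q) :=
    (Real.rpow_le_rpow (norm_nonneg _) (norm_sub_le _ _) hq0).trans
      (add_rpow_le_two_rpow_mul (norm_nonneg _) (norm_nonneg _) hq0)
  have hi3 : Integrable (fun ω => ‖Y ω - a‖ ^ q) P := by
    refine hi2.mono' ?_ (ae_of_all _ fun ω => ?_)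
    · exact ((hY.sub (integrable_const a)).aestronglyMeasurable.norm.aemeasurable.pow_const
        q).aestronglyMeasurable
    · rw [Real.norm_of_nonneg (by positivity)]
      exact hle ω
  refine ⟨haM, hi3, (integral_mono hi3 hi2 hle).trans ?_⟩
  rw [integral_const_mul, integral_add hYq (integrable_const _)]
  simp only [integral_const, probReal_univ, one_smul]
  gcongr

/-- The dispersion is not changed by an additive constant, and is a sum of variances. -/
lemma dispersion_eq {Ω E : Type*} [MeasurableSpace Ω] [MeasurableSpace E] {P : Measure Ω}
    {V : ℕ → Measure E} [∀ j, IsProbabilityMeasure (V j)] {X : ℕ → Ω → E}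
    (hX : ∀ j, HasLaw (X j) (V j) P) {g h : E → ℝ} (hg : ∀ j, MemLp g 2 (V j)) {c : ℝ}
    (hh : ∀ y, h y = g y + c) (n : ℕ) :
    dispersion V h n = √(∑ j ∈ Finset.range n, ∫ ω, (g (X j ω) - ∫ y, g y ∂(V j)) ^ 2 ∂P) := by
  rw [dispersion]
  congr 1
  refine Finset.sum_congr rfl fun j _ => ?_
  have e : h = fun y => g y + c := funext hh
  have h1 : variance h (V j) = variance g (V j) := by
    rw [e, variance_add_const (hg j).aestronglyMeasurable]
  have h2 : MemLp h 2 (V j) := by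
    rw [e]; exact (hg j).add (memLp_const c)
  have h3 := variance_eq_sub h2
  have h4 := (hX j).integral_comp (f := fun x => (g x - ∫ y, g y ∂(V j)) ^ 2)
    (((hg j).sub (memLp_const _)).integrable_sq.aestronglyMeasurable)
  have h5 := variance_eq_integral (hg j).aestronglyMeasurable.aemeasurable
  calc _ = variance h (V j) := by rw [h3]; rfl
    _ = ∫ x, (g x - ∫ y, g y ∂(V j)) ^ 2 ∂(V j) := by rw [h1, h5]
    _ = _ := h4.symm

end StatFun

/-! ### The limit theorem -/

open StatFun in
theorem mainTheorem3 {Ω : Type*} [MeasurableSpace Ω] (P : Measure Ω) [IsProbabilityMeasure P]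
    (k m d : ℕ) (hm : 1 ≤ m)
    (V : ℕ → Measure (Fin k → ℝ)) [∀ ν, IsProbabilityMeasure (V ν)]
    (X : ℕ → Ω → Fin k → ℝ) (hX : ∀ ν, HasLaw (X ν) (V ν) P) (hind : iIndepFun X P)
    (index : Fin d → Fin k → ℕ) (hindex : ∀ j, ∑ i, index j i ≤ m)
    (U K : Set ((Fin k → ℝ) × (Fin d → ℝ))) (hU : IsOpen U) (hK : IsCompact K) (hKU : K ⊆ U)
    (F : (Fin k → ℝ) × (Fin d → ℝ) → ℝ) (hF : ContDiffOn ℝ 2 F U)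
    (hVK : ∀ᶠ n in atTop, StatFun.momentVector index (StatFun.avgDist V n) ∈ K)
    (N : Fin k → ℝ) (hN : ∀ i, 0 < N i) (C ε : ℝ) (hε : 0 < ε)
    (htail : StatFun.UniformTail V N C (2 * m + k + ε)) :
    (∀ᶠ n in atTop, ∃ g : (Fin k → ℝ) → ℝ,
      StatFun.HasStatDeriv (StatFun.finiteMoment k m)
        (fun W => F (StatFun.momentVector index W)) (StatFun.avgDist V n) g) ∧
    ∀ f' : ℕ → (Fin k → ℝ) → ℝ,
      (∀ᶠ n in atTop, StatFun.HasStatDeriv (StatFun.finiteMoment k m)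
        (fun W => F (StatFun.momentVector index W)) (StatFun.avgDist V n) (f' n)) →
      ∀ δ : ℝ, 0 < δ → m * δ < k + ε →
      Tendsto (fun n : ℕ => StatFun.dispersion V (f' n) n / (n : ℝ) ^ (1 / (2 + δ)))
        atTop atTop →
      TendstoUniformly
        (fun (n : ℕ) (u : ℝ) => P.real {ω | StatFun.normalizer V (f' n) n *
          (F (StatFun.momentVector index (StatFun.repartition (fun ν => X ν ω) n)) -
            F (StatFun.momentVector index (StatFun.avgDist V n))) ≤ u})
        StatFun.gaussPhi atTop := by
  have hm0 : (0 : ℝ) < m := by exact_mod_cast hm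
  have hk0 : (0 : ℝ) ≤ k := by positivity
  have hVJ (j) : V j ∈ finiteMoment k m := htail.mem_finiteMoment hN hm (by linarith) j
  have hφi (j) := integrable_monomialVector (hVJ j)
  set φ := monomialVector k m with hφ
  have hφc : Continuous φ := continuous_monomialVector k m
  set Q := momentMap (m := m) index with hQ
  have hQ2 : ContDiff ℝ 2 Q := contDiff_momentMap index
  set G := F ∘ Q with hG
  have hU' : IsOpen (Q ⁻¹' U) := hU.preimage hQ2.continuous
  have hG2 : ContDiffOn ℝ 2 G (Q ⁻¹' U) := hF.comp hQ2.contDiffOn fun _ h => h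
  have hmv {W : Measure (Fin k → ℝ)} (hW : W ∈ finiteMoment k m) :
      momentVector index W = Q (∫ y, φ y ∂W) := momentVector_eq_momentMap hm hindex hW
  set r : ℕ → multiIndices k m → ℝ := fun n => ∫ y, φ y ∂(avgDist V n) with hr
  -- For `n = 0` the average is the zero measure, hence the exclusion.
  have hnJ {n : ℕ} (hn : n ≠ 0) : avgDist V n ∈ finiteMoment k m :=
    avgDist_mem_finiteMoment hVJ hn
  have hrK : ∀ᶠ n in atTop, Q (r n) ∈ K := by
    filter_upwards [hVK, eventually_ne_atTop 0] with n hn hn0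
    rwa [← hmv (hnJ hn0)]
  have hderiv : ∀ᶠ n in atTop, HasStatDeriv (finiteMoment k m)
      (fun W => F (momentVector index W)) (avgDist V n) fun y => fderiv ℝ G (r n) (φ y) := by
    filter_upwards [hrK, eventually_ne_atTop 0] with n hn hn0
    refine hasStatDeriv_of_moments (fun W hW => by rw [hmv hW]; rfl) (hnJ hn0) ?_
    exact (hG2.contDiffAt (hU'.mem_nhds (hKU hn))).differentiableAt (by norm_num)
  refine ⟨hderiv.mono fun n hn => ⟨_, hn⟩, fun f' hf' δ hδ hδm hlim => ?_⟩
  have hq : 2 < 2 + δ := by linarith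
  -- The condition `m (2 + δ) < 2m + k + ε` is exactly `m δ < k + ε`.
  obtain ⟨M, hM⟩ := htail.exists_monomialVector_bound (m := m) hN hm
    (q := 2 + δ) (by linarith) (by linarith)
  have hYq (j) : Integrable (fun ω => ‖φ (X j ω)‖ ^ (2 + δ)) P := by
    have h := (hX j).map_eq ▸ (hM j).1
    exact h.comp_aemeasurable (hX j).aemeasurable
  have hYM (j) : ∫ ω, ‖φ (X j ω)‖ ^ (2 + δ) ∂P ≤ M :=
    ((hX j).integral_comp (hM j).1.aestronglyMeasurable).trans_le (hM j).2
  have hYi (j) : Integrable (fun ω => φ (X j ω)) P := by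
    have h := (hX j).map_eq ▸ hφi j
    exact h.comp_aemeasurable (hX j).aemeasurable
  have hYe (j) : ∫ ω, φ (X j ω) ∂P = ∫ y, φ y ∂(V j) :=
    (hX j).integral_comp (hφi j).aestronglyMeasurable
  have hbd (j) := integrable_and_integral_norm_sub_rpow_le (hYi j) (by linarith) (hYq j) (hYM j)
  simp only [hYe] at hbd
  set W : ℕ → Ω → multiIndices k m → ℝ := fun j ω => φ (X j ω) - ∫ y, φ y ∂(V j) with hW
  have hr_eq (n) : r n = (n : ℝ)⁻¹ • ∑ j ∈ Finset.range n, ∫ y, φ y ∂(V j) :=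
    integral_avgDist hφi n
  have hM0 : 0 ≤ 1 + M := (norm_nonneg _).trans (hbd 0).1
  have hrM (n) : ‖r n‖ ≤ 1 + M := by
    rw [hr_eq, norm_smul, norm_inv, Real.norm_natCast]
    refine inv_mul_le_of_le_mul₀ (Nat.cast_nonneg n) hM0 ((norm_sum_le _ _).trans ?_)
    exact (Finset.sum_le_sum fun j _ => (hbd j).1).trans_eq
      (by rw [Finset.sum_const, Finset.card_range, nsmul_eq_mul])
  -- The preimage of `K` is closed but need not be bounded; the uniform moment bound supplies a ball
  -- containing all `r n`.
  have hK' : IsCompact (Metric.closedBall 0 (1 + M) ∩ Q ⁻¹' K) :=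
    (isCompact_closedBall _ _).inter_right (hK.isClosed.preimage hQ2.continuous)
  have hind' : iIndepFun W P :=
    hind.comp (fun j x => φ x - ∫ y, φ y ∂(V j)) fun j => hφc.measurable.sub_const _
  have hφL2 (n j) : MemLp (fun y => fderiv ℝ G (r n) (φ y)) 2 (V j) := by
    have h := integrable_sq_of_integrable_rpow (Z := fun y => ‖φ y‖) hq.le
      hφc.norm.measurable.aemeasurable (by simpa using (hM j).1)
    exact (fderiv ℝ G (r n)).comp_memLp' ((memLp_norm_iff hφc.aestronglyMeasurable).1 h)
  have hdisp : ∀ᶠ n in atTop, dispersion V (f' n) n =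
      √(∑ j ∈ Finset.range n, ∫ ω, fderiv ℝ G (r n) (W j ω) ^ 2 ∂P) := by
    filter_upwards [hderiv, hf'] with n h1 h2
    obtain ⟨c, hc⟩ := h1.exists_eq_add_const h2
    rw [dispersion_eq hX (hφL2 n) hc]
    simp only [hW, map_sub, ContinuousLinearMap.integral_comp_comm _ (hφi _)]
  have key := tendstoUniformly_smooth_mean
    (fun j => (hYi j).aestronglyMeasurable.aemeasurable.sub_const _)
    hind' hq (fun j => (hbd j).2.1) (fun j => (hbd j).2.2)
    (fun j => by rw [integral_sub (hYi j) (integrable_const _), hYe]; simp)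
    hU' hK' (fun _ h => hKU h.2) hG2
    (hrK.mono fun n hn => ⟨mem_closedBall_zero_iff.2 (hrM n), hn⟩) (fun n => rfl)
    (hlim.congr' (hdisp.mono fun n hn => by rw [hn]))
  refine (tendstoUniformly_congr ?_).1 key
  filter_upwards [hdisp, eventually_ne_atTop 0] with n hn hn0
  ext u
  congr 1
  ext ω
  -- Integrals against Dirac measures are point values, and the centring terms of `W` average to `r
  -- n`.
  have e1 : momentVector index (repartition (fun ν => X ν ω) n) =
      Q (r n + (n : ℝ)⁻¹ • ∑ j ∈ Finset.range n, W j ω) := by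
    rw [repartition, hmv (avgDist_mem_finiteMoment (fun j => dirac_mem_finiteMoment _) hn0),
      integral_avgDist (fun j => integrable_monomialVector (dirac_mem_finiteMoment _)), hr_eq]
    congr 1
    simp only [integral_dirac, hW, Finset.sum_sub_distrib, smul_sub]
    abel
  have e2 : momentVector index (avgDist V n) = Q (r n) := hmv (hnJ hn0)
  change _ ≤ u ↔ _ * (_ - _) ≤ u
  rw [e1, e2, normalizer, hn]
  rfl
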